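/- **Onsager reciprocity relation at lowest order for a tunnelling junction.** Let $d\ge 3$. Consider two reservoirs $r=I,II$ of free spinless fermions in $\mathbb R^d$, with one-particle space $L^2(\mathbb R^d)$, one-particle energy $-\Delta$ (units $\hbar=1$, mass $\tfrac12$), and particle number as the only conservation law. Their field algebra is the CAR algebra $\mathcal F$ generated by annihilation operators $a(f,r)$, $f\in L^2(\mathbb R^d)$, where operators of different reservoirs anticommute. The free dynamics $\alpha^r_t$ and the gauge transformations $\varphi^r_s$ of reservoir $r$ act by $a(f,r)\mapsto a(e^{-it\Delta}f,r)$ and $a(f,r)\mapsto a(e^{is}f,r)$, and trivially on the other reservoir; $\alpha^0_t=\alpha^I_t\circ\alpha^{II}_t$. For $\beta^r>0$, $\mu^r\in\mathbb R$ let $\omega^0$ be the state in which the uncoupled reservoirs are in equilibrium at inverse temperatures $\beta^r$ and chemical potentials $\mu^r$, i.e. the gauge-invariant quasi-free state with $$\omega^0(a^*(f,r)a(g,s))=\delta_{rs}\,\big\langle g,(e^{\beta^r(-\Delta-\mu^r)}+1)^{-1}f\big\rangle .$$ For $N\ge1$ let $$W_N=\int dX\,dY\;a^*(X_1)\cdots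 a^*(X_N)\,w_N(X,Y)\,a(Y_1)\cdots a(Y_N),\qquad X_j=(x_j,r_j),\ Y_j=(y_j,r_j'),$$ be selfadjoint, where every component of the kernel $w_N$ (for fixed reservoir labels) is in $L^2(\mathbb R^{2dN})$ and has a finite norm $$\|f\|'_M=2^{-3M/2}\Big\langle f,\prod_{k=1}^M(-\partial_k^2+x_k^2+1)^3f\Big\rangle^{1/2},\qquad M=2dN,$$ the quadratic form being understood in the basis of Hermite functions. Assume also that $s\mapsto\alpha^I_s(W_N)$ is norm-differentiable at $s=0$ and that its derivative $i[H\otimes 1,W_N]$ is an operator of the same form with a kernel of finite norm. Put $W=g\sum_{N\ge1}\xi^NW_N$, and let $\alpha_t$ be the dynamics perturbed by $W$. The observables of particle gain and energy gain of reservoir $I$ per unit time are $-\frac{d}{ds}\varphi^I_s(W)|_{s=0}=-i[N\otimes1,W]$ and $-\frac{d}{ds}\alpha^I_s(W)|_{s=0}=-i[H\otimes1,W]$. The particle current $\mathcal J$ and the energy current $\mathcal P$ are their expectation values in $\omega_{\rm stat}=\lim_{t\to\infty}\omega^0\circ\alpha_t$. Let $\mathcal J_{k,l}$ and $\mathcal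 P_{k,l}$ be the terms of order $g^k\xi^l$ of $\mathcal J$ and $\mathcal P$, i.e. the limits as $t\to\infty$ of the terms of this order which one obtains from the Dyson series $$\alpha^0_{-t}\alpha_t(a)=\sum_{m\ge0}i^m\int_{t>t_m>\dots>t_1>0}dt_1\cdots dt_m\,[W(t_m),\dots[W(t_1),a]\dots],\qquad W(t)=\alpha^0_{-t}(W).$$ Then for $k=l=2$ these limits exist for all $\beta^I,\beta^{II}>0$ and $\mu^I,\mu^{II}\in\mathbb R$. Regard $\mathcal J_{2,2}$ and $\mathcal P_{2,2}$ as functions of $\beta,\nu,\Delta\beta,\Delta\nu$, where $$\beta=\beta^I,\qquad \nu=\beta^I\mu^I,\qquad \Delta\beta=\beta^I-\beta^{II},\qquad \Delta\nu=\beta^I\mu^I-\beta^{II}\mu^{II}.$$ For all $\beta>0$ and $\nu\in\mathbb R$ the following partial derivatives at $\Delta\beta=\Delta\nu=0$ exist and satisfy $$\frac{\partial\mathcal P_{2,2}}{\partial\Delta\nu}\Big|_{\Delta\beta=\Delta\nu=0}=-\frac{\partial\mathcal J_{2,2}}{\partial\Delta\beta}\Big|_{\Delta\beta=\Delta\nu=0},$$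 where the derivative in $\Delta\nu$ is taken at constant $\beta,\nu,\Delta\beta$ and the derivative in $\Delta\beta$ at constant $\beta,\nu,\Delta\nu$. -/

import Mathlib

open MeasureTheory Filter Topology
open scoped FourierTransform ENNReal ComplexOrder

noncomputable section

namespace FermiJunction

/-- The labels of the two reservoirs. -/
inductive Reservoir where
  | I
  | II
  deriving DecidableEq

/-- Physical space `ℝ^d` with its Euclidean norm. -/
abbrev Space (d : ℕ) : Type := EuclideanSpace ℝ (Fin d)

/-- The one-particle space `L²(ℝ^d)` of a spinless particle. -/
abbrev OneParticle (d : ℕ) : Type := Lp ℂ 2 (volume : Measure (Space d))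

open Classical in
/-- The class in `L²(ℝ^d)` of a square-integrable function (zero for any other function). -/
def toL2 {d : ℕ} (f : Space d → ℂ) : OneParticle d :=
  if h : MemLp f 2 (volume : Measure (Space d)) then h.toLp f else 0

/-- The function `m(-Δ)` of the one-particle energy `-Δ`, defined through the Fourier transform.
With Mathlib's convention `𝓕 f ξ = ∫ e^{-2πi⟨x,ξ⟩} f x dx` the momentum is `k = 2πξ`, so that
`-Δ` is multiplication by `|k|² = (2π‖ξ‖)²`. It is used for bounded continuous `m`. -/
def energyFunction {d : ℕ} (m : ℝ → ℂ) (f : OneParticle d) : OneParticle d :=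
  𝓕⁻ (toL2 fun ξ : Space d => m ((2 * Real.pi * ‖ξ‖) ^ 2) * (𝓕 f : OneParticle d) ξ)

/-- The free one-particle time evolution `e^{it(-Δ)}` (in units with `ħ = 1` and mass `1/2`). -/
def freeProp {d : ℕ} (t : ℝ) : OneParticle d → OneParticle d :=
  energyFunction fun e => Complex.exp (Complex.I * (t : ℂ) * (e : ℂ))

/-- The one-particle Fermi operator `(e^{β(-Δ-μ)} + 1)⁻¹`, i.e. multiplication by
`ρ(k) = 1 / (e^{β(|k|²-μ)} + 1)` in momentum space. -/
def fermiOp {d : ℕ} (β μ : ℝ) : OneParticle d → OneParticle d :=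
  energyFunction fun e => ((1 / (Real.exp (β * (e - μ)) + 1) : ℝ) : ℂ)

/-- `A` is the CAR algebra over `L²(ℝ^d) ⊕ L²(ℝ^d)`: the C*-algebra generated by the annihilation
operators `a(f, r)` of the two reservoirs, which depend antilinearly on `f` and satisfy the
canonical anticommutation relations. Operators of different reservoirs anticommute. -/
structure CARAlgebra (d : ℕ) (A : Type*) [CStarAlgebra A] where
  /-- The annihilation operator `a(f, r)`; the creation operator `a*(f, r)` is its adjoint. -/
  annih : Reservoir → OneParticle d →ₗ⋆[ℂ] A
  anticomm : ∀ r s f g, annih r f * annih s g + annih s g * annih r f = 0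
  anticomm_star : ∀ r s f g,
    annih r f * star (annih s g) + star (annih s g) * annih r f =
      if r = s then (inner ℂ f g : ℂ) • (1 : A) else 0
  generates : (StarAlgebra.adjoin ℂ {x : A | ∃ r f, x = annih r f}).topologicalClosure = ⊤

/-- `ω` is the gauge-invariant quasi-free state with one-particle density operator `T r` in
reservoir `r` and no correlation between the reservoirs:
`ω(a*(f_m) ⋯ a*(f_1) a(g_1) ⋯ a(g_n)) = δ_{mn} det(⟨g_j, T f_i⟩)`. -/
structure CARAlgebra.IsQuasiFreeState {d : ℕ} {A : Type*} [CStarAlgebra A] (C : CARAlgebra d A)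
    (T : Reservoir → OneParticle d → OneParticle d) (ω : A →L[ℂ] ℂ) : Prop where
  unit : ω 1 = 1
  nonneg : ∀ x : A, 0 ≤ ω (star x * x)
  gauge_invariant : ∀ (m n : ℕ), m ≠ n →
    ∀ (f : Fin m → Reservoir × OneParticle d) (g : Fin n → Reservoir × OneParticle d),
      ω (star (List.ofFn fun i => C.annih (f i).1 (f i).2).prod *
        (List.ofFn fun j => C.annih (g j).1 (g j).2).prod) = 0
  wick : ∀ (n : ℕ) (f g : Fin n → Reservoir × OneParticle d),
      ω (star (List.ofFn fun i => C.annih (f i).1 (f i).2).prod *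
        (List.ofFn fun j => C.annih (g j).1 (g j).2).prod) =
      Matrix.det (Matrix.of fun i j =>
        if (f i).1 = (g j).1 then (inner ℂ (g j).2 (T (f i).1 (f i).2) : ℂ) else 0)

/-- Two infinitely extended reservoirs of free spinless fermions in `ℝ^d`: the field algebra with
the free dynamics `α_t^r` and the gauge transformations `φ_s^r` (generated by the particle number)
of each reservoir, and the states `ω⁰ = ω_{β^I,μ^I} ⊗ ω_{β^II,μ^II}` in which the uncoupled
reservoirs are in thermal equilibrium. The dynamics, the gauge transformations and the states are
determined by the values prescribed here on the generators. -/
structure FreeReservoirs (d : ℕ) (A : Type*) [CStarAlgebra A] extends CARAlgebra d A where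
  evol : Reservoir → ℝ → (A →⋆ₐ[ℂ] A)
  evol_annih : ∀ r t s f, evol r t (annih s f) = annih s (if s = r then freeProp t f else f)
  gauge : Reservoir → ℝ → (A →⋆ₐ[ℂ] A)
  gauge_annih : ∀ r t s f, gauge r t (annih s f) =
    annih s (if s = r then Complex.exp (Complex.I * (t : ℂ)) • f else f)
  equilibrium : (β μ : Reservoir → ℝ) → (A →L[ℂ] ℂ)
  equilibrium_spec : ∀ β μ : Reservoir → ℝ, (∀ r, 0 < β r) →
    toCARAlgebra.IsQuasiFreeState (fun r => fermiOp (β r) (μ r)) (equilibrium β μ)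

/-- The Hermite function `φ_q(x) = (-1)^q (2^q q!)^{-1/2} π^{-1/4} e^{x²/2} (d/dx)^q e^{-x²}`. -/
def hermiteFun (q : ℕ) (x : ℝ) : ℝ :=
  (-1) ^ q / (Real.sqrt (2 ^ q * (q.factorial : ℝ)) * Real.pi ^ (1 / 4 : ℝ)) *
    Real.exp (x ^ 2 / 2) * iteratedDeriv q (fun y : ℝ => Real.exp (-y ^ 2)) x

/-- The Hermite function of `d` variables with multi-index `q`. -/
def hermiteFunD {d : ℕ} (q : Fin d → ℕ) (x : Space d) : ℝ := ∏ i, hermiteFun (q i) (x i)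

/-- An `N`-body kernel `w_N((x, r), (y, r'))`, where `x, y ∈ (ℝ^d)^N` are positions and
`r, r'` the reservoirs of the `N` created and the `N` annihilated particles; the arguments are taken
in the order `r, r', x, y`. -/
abbrev Kernel (d N : ℕ) : Type :=
  (Fin N → Reservoir) → (Fin N → Reservoir) → (Fin N → Space d) → (Fin N → Space d) → ℂ

/-- The Hermite coefficients of the components of an `N`-body kernel. -/
def Kernel.coeff {d N : ℕ} (w : Kernel d N) (r r' : Fin N → Reservoir)
    (q q' : Fin N → Fin d → ℕ) : ℂ :=
  ∫ z : (Fin N → Space d) × (Fin N → Space d),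
    w r r' z.1 z.2 * ((∏ j, hermiteFunD (q j) (z.1 j) * hermiteFunD (q' j) (z.2 j) : ℝ) : ℂ)

/-- All components `f` of the kernel, which are functions on `ℝ^M` with `M = 2dN`, are in
`L²(ℝ^M)` and have a finite weighted Sobolev norm
`2^{-3M/2} ⟨f, ∏_k (-∂_k² + x_k² + 1)³ f⟩^{1/2}`. Since `-∂² + x² + 1` has the Hermite functions
`φ_q` as eigenfunctions, with eigenvalues `2(q + 1)`, the square of this norm is the sum below. -/
def Kernel.HasFiniteNorm {d N : ℕ} (w : Kernel d N) : Prop :=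
  ∀ r r' : Fin N → Reservoir,
    MemLp (fun z : (Fin N → Space d) × (Fin N → Space d) => w r r' z.1 z.2) 2 volume ∧
    Summable fun Q : (Fin N → Fin d → ℕ) × (Fin N → Fin d → ℕ) =>
      (∏ j, ∏ i, ((Q.1 j i : ℝ) + 1) ^ 3 * ((Q.2 j i : ℝ) + 1) ^ 3) *
        ‖w.coeff r r' Q.1 Q.2‖ ^ 2

/-- The operator `∫ dX dY a*(X_1) ⋯ a*(X_N) w(X, Y) a(Y_1) ⋯ a(Y_N)`, with `X_j = (x_j, r_j)`,
`Y_j = (y_j, r'_j)`, written in the basis of Hermite functions. For kernels of finite norm the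
series converges absolutely in norm. -/
def CARAlgebra.quantize {d : ℕ} {A : Type*} [CStarAlgebra A] (C : CARAlgebra d A) {N : ℕ}
    (w : Kernel d N) : A :=
  ∑' Q : (Fin N → Reservoir × (Fin d → ℕ)) × (Fin N → Reservoir × (Fin d → ℕ)),
    w.coeff (fun j => (Q.1 j).1) (fun j => (Q.2 j).1) (fun j => (Q.1 j).2) (fun j => (Q.2 j).2) •
      ((List.ofFn fun j =>
          star (C.annih (Q.1 j).1 (toL2 fun x => (hermiteFunD (Q.1 j).2 x : ℂ)))).prod *
        (List.ofFn fun j =>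
          C.annih (Q.2 j).1 (toL2 fun x => (hermiteFunD (Q.2 j).2 x : ℂ))).prod)

namespace FreeReservoirs

/-- The free dynamics `α_t⁰` of the two uncoupled reservoirs. -/
def freeEvol {d : ℕ} {A : Type*} [CStarAlgebra A] (S : FreeReservoirs d A) (t : ℝ) : A →⋆ₐ[ℂ] A :=
  (S.evol Reservoir.I t).comp (S.evol Reservoir.II t)

/-- The coefficient of order `g^m ξ^l` in the Dyson series
`∑_m i^m ∫_{t > t_m > ⋯ > t_1 > 0} [W(t_m), ⋯ [W(t_1), a] ⋯ ]` of `α_{-t}⁰(α_t(a))`, where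
`W(t) = α_{-t}⁰(W)` and `W = g ∑_{N ≥ 1} ξ^N W_N`. -/
def dyson {d : ℕ} {A : Type*} [CStarAlgebra A] (S : FreeReservoirs d A) (W : ℕ → A) :
    ℕ → ℕ → ℝ → A → A
  | 0, l, _, a => if l = 0 then a else 0
  | m + 1, l, t, a => ∑ N ∈ Finset.Icc 1 l, Complex.I •
      ∫ s in (0 : ℝ)..t,
        (S.freeEvol (-s) (W N) * dyson S W m (l - N) s a
          - dyson S W m (l - N) s a * S.freeEvol (-s) (W N))

/-- The coefficient of order `g^k ξ^l` in the Dyson series of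
`ω⁰(α_t(O)) = ω⁰(α_{-t}⁰(α_t(O)))`, where the observable is `O = g ∑_{N ≥ 1} ξ^N O_N`. -/
def expectationTerm {d : ℕ} {A : Type*} [CStarAlgebra A] (S : FreeReservoirs d A) (W O : ℕ → A)
    (k l : ℕ) (β μ : Reservoir → ℝ) (t : ℝ) : ℂ :=
  match k with
  | 0 => 0
  | m + 1 => ∑ N ∈ Finset.Icc 1 l, S.equilibrium β μ (S.dyson W m (l - N) t (O N))

/-- The rate of gain of particles of reservoir `I` due to the interaction `V`,
`-(d/ds) φ_s^I(V)|_{s=0} = -i[N ⊗ 1, V]`. -/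
def particleFlux {d : ℕ} {A : Type*} [CStarAlgebra A] (S : FreeReservoirs d A) (V : A) : A :=
  -deriv (fun s : ℝ => S.gauge Reservoir.I s V) 0

/-- The rate of gain of energy of reservoir `I` due to the interaction `V`,
`-(d/ds) α_s^I(V)|_{s=0} = -i[H ⊗ 1, V]`. -/
def energyFlux {d : ℕ} {A : Type*} [CStarAlgebra A] (S : FreeReservoirs d A) (V : A) : A :=
  -deriv (fun s : ℝ => S.evol Reservoir.I s V) 0

/-- The interaction `W_N` with kernel `w_N`, for all `N`. -/
def interaction {d : ℕ} {A : Type*} [CStarAlgebra A] (S : FreeReservoirs d A)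
    (w : ∀ N : ℕ, Kernel d N) (N : ℕ) : A :=
  S.quantize (w N)

/-- The term of order `g^k ξ^l` of the particle current into reservoir `I` at time `t`. -/
def particleCurrentAt {d : ℕ} {A : Type*} [CStarAlgebra A] (S : FreeReservoirs d A)
    (w : ∀ N : ℕ, Kernel d N) (k l : ℕ) (β μ : Reservoir → ℝ) (t : ℝ) : ℂ :=
  S.expectationTerm (S.interaction w) (fun N => S.particleFlux (S.interaction w N)) k l β μ t

/-- The term of order `g^k ξ^l` of the energy current into reservoir `I` at time `t`. -/
def energyCurrentAt {d : ℕ} {A : Type*} [CStarAlgebra A] (S : FreeReservoirs d A)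
    (w : ∀ N : ℕ, Kernel d N) (k l : ℕ) (β μ : Reservoir → ℝ) (t : ℝ) : ℂ :=
  S.expectationTerm (S.interaction w) (fun N => S.energyFlux (S.interaction w N)) k l β μ t

/-- The term `𝒥_{k,l}` of order `g^k ξ^l` of the particle current in the stationary state
`ω_stat = lim_{t → ∞} ω⁰ ∘ α_t`. -/
def particleCurrent {d : ℕ} {A : Type*} [CStarAlgebra A] (S : FreeReservoirs d A)
    (w : ∀ N : ℕ, Kernel d N) (k l : ℕ) (β μ : Reservoir → ℝ) : ℂ :=
  limUnder atTop (S.particleCurrentAt w k l β μ)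

/-- The term `𝒫_{k,l}` of order `g^k ξ^l` of the energy current in the stationary state
`ω_stat = lim_{t → ∞} ω⁰ ∘ α_t`. -/
def energyCurrent {d : ℕ} {A : Type*} [CStarAlgebra A] (S : FreeReservoirs d A)
    (w : ∀ N : ℕ, Kernel d N) (k l : ℕ) (β μ : Reservoir → ℝ) : ℂ :=
  limUnder atTop (S.energyCurrentAt w k l β μ)

end FreeReservoirs

/-- The inverse temperatures `β^I = β`, `β^II = β - Δβ`. -/
def invTemp (β Δβ : ℝ) : Reservoir → ℝ
  | Reservoir.I => β
  | Reservoir.II => β - Δβ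

/-- The chemical potentials with `β^I μ^I = ν` and `β^I μ^I - β^II μ^II = Δν`, where `β^I = β`
and `β^II = β - Δβ`. -/
def chemPot (β ν Δβ Δν : ℝ) : Reservoir → ℝ
  | Reservoir.I => ν / β
  | Reservoir.II => (ν - Δν) / (β - Δβ)

end FermiJunction

end

/-! At order g²ξ² only the one-body interaction W₁ enters, once in the flux and once in a single
Dyson commutator. A commutator of two bilinears a*a is again bilinear (`CARAlgebra.commutator_hop`),
so its expectation in ω⁰ needs only the two-point function and is linear in the Fermi functions ρ^I,
ρ^II. Each current is therefore a ρ^I-part plus a ρ^II-part, and at fixed β, ν only the latter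
varies.

Let c_{rs} be the components of the kernel, h = -Δ, G_m(t) = tr(m(h) e^{-ith} c_{II,I} e^{ith}
c_{I,II}) and Λ(m) = ∫_ℝ G_m(t) dt (`netTransport`). The ρ^II-part of the particle current is
Λ(ρ^II) (`transport_particleCoeff`): cyclicity of the trace (`corr_swap`) turns the second half of
the commutator into the integral over negative times. The ρ^II-part of the energy current is
Λ(hρ^II) (`transport_energy`): the flux kernel is the derivative of the kernel under the evolution
of reservoir I, and integration by parts in t trades it for the energy of the particle of reservoir
II, the boundary terms cancelling.

With σ(y) = 1/(e^y + 1) one has ρ^II(e) = σ((β-Δβ)e - (ν-Δν)). At Δβ = Δν = 0 its derivatives in Δν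
and Δβ are σ' and -eσ' at βe - ν, so the two derivatives of the currents are Λ(eσ') and -Λ(eσ').

The analytic content is that Λ converges absolutely and is bounded by the supremum of |m| over e ≥ 0
(`norm_netTransport_le`). This combines the dispersive bound |t|^{-d/2}, integrable at infinity for
d ≥ 3 (`norm_inner_freeProp_le`), the growth of the L¹ norms of Hermite functions
(`integral_abs_hermiteFun_le`), and the summability of the kernel coefficients against these norms
(`Kernel.HasFiniteNorm.tame`). Differentiability of the currents then follows from Taylor bounds for
σ that are uniform in the energy (`abs_sigmoid_taylor_le`). -/

namespace FermiJunction

variable {d : ℕ}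

/-! ### Bounded functions of the one-particle energy. -/

/-- `m` is a measurable function of the energy which is bounded by `C` at positive energies. -/
def EnergyBound (m : ℝ → ℂ) (C : ℝ) : Prop := Measurable m ∧ ∀ e, 0 ≤ e → ‖m e‖ ≤ C

lemma EnergyBound.mul {m m' : ℝ → ℂ} {C C' : ℝ} (h : EnergyBound m C) (h' : EnergyBound m' C') :
    EnergyBound (fun e => m e * m' e) (C * C') :=
  ⟨h.1.mul h'.1, fun e he => by
    rw [norm_mul]
    exact mul_le_mul (h.2 e he) (h'.2 e he) (norm_nonneg _) ((norm_nonneg _).trans (h.2 e he))⟩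

lemma EnergyBound.add {m m' : ℝ → ℂ} {C C' : ℝ} (h : EnergyBound m C) (h' : EnergyBound m' C') :
    EnergyBound (fun e => m e + m' e) (C + C') :=
  ⟨h.1.add h'.1, fun e he => (norm_add_le _ _).trans (add_le_add (h.2 e he) (h'.2 e he))⟩

lemma EnergyBound.const_mul {m : ℝ → ℂ} {C : ℝ} (h : EnergyBound m C) (a : ℂ) :
    EnergyBound (fun e => a * m e) (‖a‖ * C) :=
  ⟨h.1.const_mul a, fun e he => by
    rw [norm_mul]; exact mul_le_mul_of_nonneg_left (h.2 e he) (norm_nonneg _)⟩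

lemma EnergyBound.conj {m : ℝ → ℂ} {C : ℝ} (h : EnergyBound m C) :
    EnergyBound (fun e => starRingEnd ℂ (m e)) C :=
  ⟨Complex.continuous_conj.measurable.comp h.1, fun e he => by simpa using h.2 e he⟩

lemma EnergyBound.nonneg {m : ℝ → ℂ} {C : ℝ} (h : EnergyBound m C) : 0 ≤ C :=
  (norm_nonneg _).trans (h.2 0 le_rfl)

lemma EnergyBound.mono {m : ℝ → ℂ} {C C' : ℝ} (h : EnergyBound m C) (hC : C ≤ C') :
    EnergyBound m C' := ⟨h.1, fun e he => (h.2 e he).trans hC⟩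

lemma toL2_of_memLp {f : Space d → ℂ} (h : MemLp f 2 (volume : Measure (Space d))) :
    toL2 f = h.toLp f := by rw [toL2, dif_pos h]

lemma coeFn_toL2 {f : Space d → ℂ} (h : MemLp f 2 (volume : Measure (Space d))) :
    (toL2 f : Space d → ℂ) =ᵐ[volume] f := by
  rw [toL2_of_memLp h]; exact h.coeFn_toLp

lemma EnergyBound.measurable_symbol {m : ℝ → ℂ} {C : ℝ} (h : EnergyBound m C) :
    Measurable fun ξ : Space d => m ((2 * Real.pi * ‖ξ‖) ^ 2) :=
  h.1.comp (by fun_prop)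

lemma EnergyBound.norm_symbol_le {m : ℝ → ℂ} {C : ℝ} (h : EnergyBound m C) (ξ : Space d) :
    ‖m ((2 * Real.pi * ‖ξ‖) ^ 2)‖ ≤ C := h.2 _ (sq_nonneg _)

lemma EnergyBound.memLp_mul {m : ℝ → ℂ} {C : ℝ} (h : EnergyBound m C) (g : OneParticle d) :
    MemLp (fun ξ : Space d => m ((2 * Real.pi * ‖ξ‖) ^ 2) * g ξ) 2
      (volume : Measure (Space d)) := by
  refine (Lp.memLp g).of_le_mul (c := C) (h.measurable_symbol.aestronglyMeasurable.mul
    (Lp.memLp g).1) (ae_of_all _ fun ξ => ?_)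
  rw [norm_mul]
  exact mul_le_mul_of_nonneg_right (h.norm_symbol_le ξ) (norm_nonneg _)

lemma fourier_energyFunction {m : ℝ → ℂ} {C : ℝ} (h : EnergyBound m C) (f : OneParticle d) :
    (𝓕 (energyFunction m f) : OneParticle d) =ᵐ[volume]
      fun ξ => m ((2 * Real.pi * ‖ξ‖) ^ 2) * (𝓕 f : OneParticle d) ξ := by
  rw [energyFunction, FourierTransform.fourier_fourierInv_eq]
  exact coeFn_toL2 (h.memLp_mul _)

lemma eq_of_fourier_ae {f g : OneParticle d}
    (h : ((𝓕 f : OneParticle d) : Space d → ℂ) =ᵐ[volume] (𝓕 g : OneParticle d)) : f = g := by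
  have := Lp.ext h
  exact (Lp.fourierTransformₗᵢ (Space d) ℂ).injective this

lemma inner_energyFunction {m : ℝ → ℂ} {C : ℝ} (h : EnergyBound m C) (f g : OneParticle d) :
    (inner ℂ f (energyFunction m g) : ℂ) = ∫ ξ : Space d, m ((2 * Real.pi * ‖ξ‖) ^ 2) *
      ((𝓕 g : OneParticle d) ξ * starRingEnd ℂ ((𝓕 f : OneParticle d) ξ)) := by
  rw [← Lp.inner_fourier_eq, L2.inner_def]
  refine integral_congr_ae ?_
  filter_upwards [fourier_energyFunction h g] with ξ hξ
  rw [hξ, RCLike.inner_apply]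
  ring

lemma integrable_fourier_mul_conj (f g : OneParticle d) :
    Integrable fun ξ : Space d => (𝓕 g : OneParticle d) ξ * starRingEnd ℂ ((𝓕 f : OneParticle d) ξ) := by
  have := L2.integrable_inner (𝕜 := ℂ) (𝓕 f : OneParticle d) (𝓕 g)
  simpa [RCLike.inner_apply] using this

lemma inner_energyFunction_left {m : ℝ → ℂ} {C : ℝ} (h : EnergyBound m C) (f g : OneParticle d) :
    (inner ℂ (energyFunction m f) g : ℂ) =
      inner ℂ f (energyFunction (fun e => starRingEnd ℂ (m e)) g) := by
  rw [← inner_conj_symm, inner_energyFunction h, inner_energyFunction h.conj, ← integral_conj]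
  refine integral_congr_ae (ae_of_all _ fun ξ => ?_)
  simp only [map_mul, Complex.conj_conj]
  ring

lemma norm_energyFunction_le {m : ℝ → ℂ} {C : ℝ} (h : EnergyBound m C) (f : OneParticle d) :
    ‖energyFunction m f‖ ≤ C * ‖f‖ := by
  rw [← Lp.norm_fourier_eq (energyFunction m f), ← Lp.norm_fourier_eq f]
  refine Lp.norm_le_mul_norm_of_ae_le_mul ?_
  filter_upwards [fourier_energyFunction h f] with ξ hξ
  rw [hξ, norm_mul]
  exact mul_le_mul_of_nonneg_right (h.norm_symbol_le ξ) (norm_nonneg _)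

lemma fourier_Lp_add (f g : OneParticle d) :
    (𝓕 (f + g) : OneParticle d) = 𝓕 f + 𝓕 g := (Lp.fourierTransformₗᵢ (Space d) ℂ).map_add f g

lemma fourier_Lp_smul (a : ℂ) (f : OneParticle d) :
    (𝓕 (a • f) : OneParticle d) = a • 𝓕 f := (Lp.fourierTransformₗᵢ (Space d) ℂ).map_smul a f

lemma energyFunction_add {m : ℝ → ℂ} {C : ℝ} (h : EnergyBound m C) (f g : OneParticle d) :
    energyFunction m (f + g) = energyFunction m f + energyFunction m g := by
  apply eq_of_fourier_ae
  rw [fourier_Lp_add]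
  filter_upwards [fourier_energyFunction h (f + g), fourier_energyFunction h f,
    fourier_energyFunction h g, Lp.coeFn_add (𝓕 f : OneParticle d) (𝓕 g),
    Lp.coeFn_add (𝓕 (energyFunction m f) : OneParticle d) (𝓕 (energyFunction m g))]
    with ξ h1 h2 h3 h4 h5
  rw [h1, h5, Pi.add_apply, h2, h3, fourier_Lp_add, h4, Pi.add_apply, mul_add]

lemma energyFunction_smul {m : ℝ → ℂ} {C : ℝ} (h : EnergyBound m C) (a : ℂ) (f : OneParticle d) :
    energyFunction m (a • f) = a • energyFunction m f := by
  apply eq_of_fourier_ae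
  rw [fourier_Lp_smul]
  filter_upwards [fourier_energyFunction h (a • f), fourier_energyFunction h f,
    Lp.coeFn_smul a (𝓕 f : OneParticle d),
    Lp.coeFn_smul a (𝓕 (energyFunction m f) : OneParticle d)] with ξ h1 h2 h3 h4
  rw [h1, h4, Pi.smul_apply, h2, fourier_Lp_smul, h3, Pi.smul_apply, smul_eq_mul, smul_eq_mul]
  ring

lemma energyFunction_sub {m : ℝ → ℂ} {C : ℝ} (h : EnergyBound m C) (f g : OneParticle d) :
    energyFunction m (f - g) = energyFunction m f - energyFunction m g := by
  rw [sub_eq_add_neg, ← neg_one_smul ℂ g, energyFunction_add h, energyFunction_smul h,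
    neg_one_smul, sub_eq_add_neg]

lemma energyFunction_energyFunction {m m' : ℝ → ℂ} {C C' : ℝ} (h : EnergyBound m C)
    (h' : EnergyBound m' C') (f : OneParticle d) :
    energyFunction m (energyFunction m' f) = energyFunction (fun e => m e * m' e) f := by
  apply eq_of_fourier_ae
  filter_upwards [fourier_energyFunction h (energyFunction m' f), fourier_energyFunction h' f,
    fourier_energyFunction (h.mul h') f] with ξ h1 h2 h3
  rw [h1, h2, h3]; exact (mul_assoc _ _ _).symm

lemma energyFunction_add_fun {m m' : ℝ → ℂ} {C C' : ℝ} (h : EnergyBound m C)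
    (h' : EnergyBound m' C') (f : OneParticle d) :
    energyFunction (fun e => m e + m' e) f = energyFunction m f + energyFunction m' f := by
  apply eq_of_fourier_ae
  rw [fourier_Lp_add]
  filter_upwards [fourier_energyFunction (h.add h') f, fourier_energyFunction h f,
    fourier_energyFunction h' f,
    Lp.coeFn_add (𝓕 (energyFunction m f) : OneParticle d) (𝓕 (energyFunction m' f))]
    with ξ h1 h2 h3 h4
  rw [h1, h4, Pi.add_apply, h2, h3, add_mul]

lemma energyFunction_const_mul {m : ℝ → ℂ} {C : ℝ} (h : EnergyBound m C) (a : ℂ)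
    (f : OneParticle d) :
    energyFunction (fun e => a * m e) f = a • energyFunction m f := by
  apply eq_of_fourier_ae
  rw [fourier_Lp_smul]
  filter_upwards [fourier_energyFunction (h.const_mul a) f, fourier_energyFunction h f,
    Lp.coeFn_smul a (𝓕 (energyFunction m f) : OneParticle d)] with ξ h1 h2 h3
  rw [h1, h3, Pi.smul_apply, h2, smul_eq_mul, mul_assoc]

lemma energyFunction_one (f : OneParticle d) : energyFunction (fun _ => 1) f = f := by
  have h : EnergyBound (fun _ => (1 : ℂ)) 1 := ⟨measurable_const, fun e _ => by simp⟩
  apply eq_of_fourier_ae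
  filter_upwards [fourier_energyFunction h f] with ξ h1
  rw [h1, one_mul]

/-! ### The free one-particle evolution as a strongly continuous unitary group. -/

/-- The symbol of the free time evolution. -/
noncomputable def phase (t : ℝ) (e : ℝ) : ℂ := Complex.exp (Complex.I * (t : ℂ) * (e : ℂ))

lemma norm_phase (t e : ℝ) : ‖phase t e‖ = 1 := by
  rw [phase, mul_assoc, mul_comm, ← Complex.ofReal_mul, Complex.norm_exp_ofReal_mul_I]

lemma phase_bound (t : ℝ) : EnergyBound (phase t) 1 :=
  ⟨by unfold phase; fun_prop, fun e _ => (norm_phase t e).le⟩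

lemma freeProp_eq (t : ℝ) (f : OneParticle d) : freeProp t f = energyFunction (phase t) f := rfl

lemma conj_phase (t e : ℝ) : starRingEnd ℂ (phase t e) = phase (-t) e := by
  rw [phase, phase, ← Complex.exp_conj]
  simp

lemma phase_mul_phase (s t e : ℝ) : phase s e * phase t e = phase (s + t) e := by
  rw [phase, phase, phase, ← Complex.exp_add]
  push_cast
  ring_nf

lemma freeProp_zero (f : OneParticle d) : freeProp 0 f = f := by
  rw [freeProp_eq]
  convert energyFunction_one f using 2
  funext e
  simp [phase]

lemma freeProp_freeProp (s t : ℝ) (f : OneParticle d) :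
    freeProp s (freeProp t f) = freeProp (s + t) f := by
  simp only [freeProp_eq, energyFunction_energyFunction (phase_bound s) (phase_bound t),
    phase_mul_phase]

lemma freeProp_energyFunction {m : ℝ → ℂ} {C : ℝ} (h : EnergyBound m C) (t : ℝ)
    (f : OneParticle d) : freeProp t (energyFunction m f) = energyFunction m (freeProp t f) := by
  simp only [freeProp_eq, energyFunction_energyFunction (phase_bound t) h,
    energyFunction_energyFunction h (phase_bound t), mul_comm]

lemma inner_freeProp_left (t : ℝ) (f g : OneParticle d) :
    (inner ℂ (freeProp t f) g : ℂ) = inner ℂ f (freeProp (-t) g) := by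
  rw [freeProp_eq, inner_energyFunction_left (phase_bound t)]
  simp only [conj_phase, freeProp_eq]

lemma inner_freeProp_freeProp (t : ℝ) (f g : OneParticle d) :
    (inner ℂ (freeProp t f) (freeProp t g) : ℂ) = inner ℂ f g := by
  rw [inner_freeProp_left, freeProp_freeProp, neg_add_cancel, freeProp_zero]

lemma norm_freeProp (t : ℝ) (f : OneParticle d) : ‖freeProp t f‖ = ‖f‖ := by
  rw [← sq_eq_sq₀ (norm_nonneg _) (norm_nonneg _)]
  have := inner_freeProp_freeProp t f f
  rw [inner_self_eq_norm_sq_to_K, inner_self_eq_norm_sq_to_K] at this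
  exact_mod_cast this

lemma continuous_inner_freeProp (f g : OneParticle d) :
    Continuous fun t : ℝ => (inner ℂ f (freeProp t g) : ℂ) := by
  simp only [freeProp_eq, inner_energyFunction (phase_bound _)]
  refine continuous_of_dominated (bound := fun ξ => ‖(𝓕 g : OneParticle d) ξ *
    starRingEnd ℂ ((𝓕 f : OneParticle d) ξ)‖) (fun t => ?_) (fun t => ae_of_all _ fun ξ => ?_)
    (integrable_fourier_mul_conj f g).norm (ae_of_all _ fun ξ => ?_)
  · exact (phase_bound t).measurable_symbol.aestronglyMeasurable.mul
      (integrable_fourier_mul_conj f g).1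
  · rw [norm_mul, norm_phase, one_mul]
  · unfold phase; fun_prop

/-- Unitarity upgrades weak to strong continuity: ‖U_t f - U_s f‖² = 2‖f‖² - 2 Re⟨f, U_{s-t} f⟩. -/
lemma continuous_freeProp (f : OneParticle d) : Continuous fun t : ℝ => freeProp t f := by
  rw [continuous_iff_continuousAt]
  intro s
  rw [ContinuousAt, tendsto_iff_norm_sub_tendsto_zero]
  have key : ∀ t, ‖freeProp t f - freeProp s f‖ =
      Real.sqrt (2 * ‖f‖ ^ 2 - 2 * RCLike.re (inner ℂ f (freeProp (s - t) f) : ℂ)) := by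
    intro t
    rw [eq_comm, Real.sqrt_eq_iff_eq_sq _ (norm_nonneg _) , @norm_sub_sq ℂ, norm_freeProp,
      norm_freeProp, inner_freeProp_left, freeProp_freeProp, neg_add_eq_sub]
    · ring
    · have := re_inner_le_norm (𝕜 := ℂ) f (freeProp (s - t) f)
      rw [norm_freeProp] at this
      nlinarith
  simp only [key]
  have hc : Continuous fun t : ℝ =>
      Real.sqrt (2 * ‖f‖ ^ 2 - 2 * RCLike.re (inner ℂ f (freeProp (s - t) f) : ℂ)) := by
    have := (continuous_inner_freeProp f f).comp (continuous_const.sub continuous_id : Continuous fun t : ℝ => s - t)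
    exact ((continuous_const.sub (continuous_const.mul (RCLike.continuous_re.comp this)))).sqrt
  have := hc.tendsto s
  rwa [sub_self, freeProp_zero, inner_self_eq_norm_sq, sub_self, Real.sqrt_zero] at this

/-- A family of functions of the energy which is differentiable with a quadratic remainder, uniformly
in the energy, is strongly differentiable. -/
lemma hasDerivAt_energyFunction {m : ℝ → ℝ → ℂ} {m' : ℝ → ℂ} {t C₀ C₁ C : ℝ}
    (hm : ∀ s, EnergyBound (m s) C₀) (hm' : EnergyBound m' C₁)
    (h : ∀ s e, 0 ≤ e → ‖m s e - m t e - (s - t : ℝ) * m' e‖ ≤ C * (s - t) ^ 2)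
    (f : OneParticle d) :
    HasDerivAt (fun s => energyFunction (m s) f) (energyFunction m' f) t := by
  rw [hasDerivAt_iff_isLittleO]
  have h1 : ∀ s, energyFunction (m s) f - energyFunction (m t) f - (s - t) • energyFunction m' f
      = energyFunction (fun e => m s e + ((-1) * m t e + (-(s - t : ℝ) : ℂ) * m' e)) f := by
    intro s
    rw [energyFunction_add_fun (hm s) (((hm t).const_mul _).add (hm'.const_mul _)),
      energyFunction_add_fun ((hm t).const_mul _) (hm'.const_mul _),
      energyFunction_const_mul (hm t), energyFunction_const_mul hm']
    have : (s - t) • energyFunction m' f = ((s - t : ℝ) : ℂ) • energyFunction m' f := rfl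
    rw [this]
    module
  have h2 : (fun s => energyFunction (m s) f - energyFunction (m t) f -
      (s - t) • energyFunction m' f) =O[𝓝 t] fun s => (s - t) ^ 2 := by
    refine Asymptotics.IsBigO.of_bound (C * ‖f‖) (Eventually.of_forall fun s => ?_)
    rw [h1, Real.norm_of_nonneg (sq_nonneg _), mul_right_comm]
    refine norm_energyFunction_le ⟨((hm s).1.add (((hm t).1.const_mul _).add (hm'.1.const_mul _))),
      fun e he => ?_⟩ f
    have := h s e he
    rwa [show m s e - m t e - (s - t : ℝ) * m' e =
      m s e + ((-1) * m t e + (-(s - t : ℝ) : ℂ) * m' e) by ring] at this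
  refine h2.trans_isLittleO ?_
  have := Asymptotics.isLittleO_pow_sub_sub t (one_lt_two : 1 < 2)
  simpa using this

/-! ### The Fourier transform on L¹ ∩ L² and the dispersive estimate. -/

lemma continuous_fourier_of_integrable {f : Space d → ℂ} (hf : Integrable f) :
    Continuous (𝓕 f : Space d → ℂ) :=
  VectorFourier.fourierIntegral_continuous Real.continuous_fourierChar
    (by exact continuous_inner) hf

lemma norm_fourier_le_integral (f : Space d → ℂ) (ξ : Space d) :
    ‖(𝓕 f : Space d → ℂ) ξ‖ ≤ ∫ x, ‖f x‖ :=
  VectorFourier.norm_fourierIntegral_le_integral_norm _ _ _ _ _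

lemma integral_fourier_mul {f g : Space d → ℂ} (hf : Integrable f) (hg : Integrable g) :
    ∫ ξ, (𝓕 f : Space d → ℂ) ξ * g ξ = ∫ x, f x * (𝓕 g : Space d → ℂ) x := by
  simpa using! (VectorFourier.integral_fourierIntegral_smul_eq_flip (L := innerₗ (Space d))
      Real.continuous_fourierChar continuous_inner hf hg)

/-- On `L¹ ∩ L²` the two definitions of the Fourier transform agree. -/
lemma fourier_toL2 {f : Space d → ℂ} (h1 : Integrable f)
    (h2 : MemLp f 2 (volume : Measure (Space d))) :
    (𝓕 (toL2 f) : OneParticle d) =ᵐ[volume] (𝓕 f : Space d → ℂ) := by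
  -- Both sides are tested against smooth compactly supported g. Read as tempered distributions, the
  -- L² transform moves onto the test function, where it is the integral transform.
  refine ae_eq_of_integral_contDiff_smul_eq ((Lp.memLp _).locallyIntegrable (by norm_num))
    (continuous_fourier_of_integrable h1).locallyIntegrable fun g hg hgc => ?_
  have hc : HasCompactSupport (Complex.ofRealCLM ∘ g) := hgc.comp_left rfl
  have hs : ContDiff ℝ ((⊤ : ℕ∞) : WithTop ℕ∞) (Complex.ofRealCLM ∘ g) := by fun_prop
  set G : SchwartzMap (Space d) ℂ := hc.toSchwartzMap hs with hG
  have hGg : ∀ x, G x = (g x : ℂ) := fun x => rfl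
  have e1 : (Lp.toTemperedDistribution (𝓕 (toL2 f) : OneParticle d)) G =
      Lp.toTemperedDistribution (toL2 f) (𝓕 G) := by
    rw [← Lp.fourier_toTemperedDistribution_eq, TemperedDistribution.fourier_apply]
  rw [Lp.toTemperedDistribution_apply, Lp.toTemperedDistribution_apply] at e1
  have e2 : ∫ x, (𝓕 G : SchwartzMap (Space d) ℂ) x • (toL2 f : Space d → ℂ) x =
      ∫ x, (𝓕 (G : Space d → ℂ) : Space d → ℂ) x * f x := by
    refine integral_congr_ae ?_
    filter_upwards [coeFn_toL2 h2] with x hx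
    rw [hx, SchwartzMap.fourier_coe, smul_eq_mul]
  rw [e2, integral_fourier_mul G.integrable h1] at e1
  simpa [hGg, Complex.real_smul] using e1

/-- Moving the transform from f onto the Gaussian gives a Gaussian of modulus at most (π/|b|)^{d/2}.
This involves |b| and not Re b, so it survives the limit Re b → 0. -/
lemma norm_integral_gaussian_fourier_le {f : Space d → ℂ} (hf : Integrable f) {b : ℂ}
    (hb : 0 < b.re) (x : Space d) :
    ‖∫ ξ : Space d, Complex.exp (-b * ‖ξ‖ ^ 2 + 2 * Real.pi * Complex.I * (inner ℝ x ξ : ℝ)) *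
      (𝓕 f : Space d → ℂ) ξ‖ ≤ (Real.pi / ‖b‖) ^ ((d : ℝ) / 2) * ∫ y, ‖f y‖ := by
  have J : Integrable (fun ξ : Space d =>
      Complex.exp (-b * ‖ξ‖ ^ 2 + 2 * Real.pi * Complex.I * (inner ℝ x ξ : ℝ))) :=
    GaussianFourier.integrable_cexp_neg_mul_sq_norm_add hb _ _
  rw [show (∫ ξ : Space d, Complex.exp (-b * ‖ξ‖ ^ 2 + 2 * Real.pi * Complex.I * (inner ℝ x ξ : ℝ)) *
      (𝓕 f : Space d → ℂ) ξ) = _ from (integral_fourier_mul J hf).symm, ← integral_const_mul]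
  refine norm_integral_le_of_norm_le (hf.norm.const_mul _) (ae_of_all _ fun y => ?_)
  rw [norm_mul]
  refine mul_le_mul_of_nonneg_right ?_ (norm_nonneg _)
  rw [fourier_gaussian_innerProductSpace' hb, norm_mul]
  have h1 : ‖(Real.pi / b : ℂ) ^ (Module.finrank ℝ (Space d) / 2 : ℂ)‖ =
      (Real.pi / ‖b‖) ^ ((d : ℝ) / 2) := by
    rw [finrank_euclideanSpace_fin, show ((d : ℂ) / 2) = (((d : ℝ) / 2 : ℝ) : ℂ) by push_cast; rfl,
      Complex.norm_cpow_real, norm_div, Complex.norm_real, Real.norm_of_nonneg Real.pi_pos.le]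
  have h2 : ‖Complex.exp (-Real.pi ^ 2 * ‖x - y‖ ^ 2 / b)‖ ≤ 1 := by
    rw [Complex.norm_exp, Real.exp_le_one_iff]
    have : (-(Real.pi : ℂ) ^ 2 * ‖x - y‖ ^ 2 / b) =
        ((-(Real.pi ^ 2 * ‖x - y‖ ^ 2) : ℝ) : ℂ) * b⁻¹ := by push_cast; ring
    rw [this, Complex.re_ofReal_mul, Complex.inv_re]
    have : 0 ≤ b.re / Complex.normSq b := div_nonneg hb.le (Complex.normSq_nonneg _)
    nlinarith [mul_nonneg (sq_nonneg Real.pi) (sq_nonneg ‖x - y‖)]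
  rw [h1]
  exact mul_le_of_le_one_right (by positivity) h2

/-- The conjugate of 𝓕 f is the transform of x ↦ conj f(-x). Moving the transform off g as well
leaves the previous integral, evaluated at -x. -/
lemma norm_integral_gaussian_fourier_fourier_le {f g : Space d → ℂ} (hf : Integrable f)
    (hg : Integrable g) {b : ℂ} (hb : 0 < b.re) :
    ‖∫ ξ : Space d, Complex.exp (-b * ‖ξ‖ ^ 2) *
      ((𝓕 g : Space d → ℂ) ξ * starRingEnd ℂ ((𝓕 f : Space d → ℂ) ξ))‖ ≤
      (Real.pi / ‖b‖) ^ ((d : ℝ) / 2) * (∫ y, ‖f y‖) * ∫ y, ‖g y‖ := by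
  set f' : Space d → ℂ := fun x => starRingEnd ℂ (f (-x)) with hf'
  have hf'i : Integrable f' := by
    have : Integrable fun x => f (-x) := hf.comp_neg
    exact (Complex.conjLIE.integrable_comp_iff (φ := fun x => f (-x))).2 this
  have hconj : ∀ ξ, starRingEnd ℂ ((𝓕 f : Space d → ℂ) ξ) = (𝓕 f' : Space d → ℂ) ξ := by
    intro ξ
    rw [Real.fourier_eq', Real.fourier_eq', ← integral_conj, ← integral_neg_eq_self]
    refine integral_congr_ae (ae_of_all _ fun x => ?_)
    have h2 : starRingEnd ℂ 2 = 2 := map_ofNat _ 2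
    simp [hf', ← Complex.exp_conj, h2]
  have hnorm : ∫ y, ‖f' y‖ = ∫ y, ‖f y‖ := by
    simp only [hf', RCLike.norm_conj]
    exact integral_neg_eq_self (fun y => ‖f y‖) _
  have hG : Integrable (fun ξ : Space d => Complex.exp (-b * ‖ξ‖ ^ 2)) := by
    simpa using GaussianFourier.integrable_cexp_neg_mul_sq_norm_add hb 0 (0 : Space d)
  have hh : Integrable (fun ξ : Space d => Complex.exp (-b * ‖ξ‖ ^ 2) * (𝓕 f' : Space d → ℂ) ξ) :=
    hG.mul_bdd (c := ∫ y, ‖f' y‖) (continuous_fourier_of_integrable hf'i).aestronglyMeasurable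
      (ae_of_all _ fun ξ => norm_fourier_le_integral _ _)
  have e1 : ∫ ξ : Space d, Complex.exp (-b * ‖ξ‖ ^ 2) *
      ((𝓕 g : Space d → ℂ) ξ * starRingEnd ℂ ((𝓕 f : Space d → ℂ) ξ)) =
      ∫ x, g x * (𝓕 (fun ξ : Space d => Complex.exp (-b * ‖ξ‖ ^ 2) * (𝓕 f' : Space d → ℂ) ξ) :
        Space d → ℂ) x := by
    rw [← integral_fourier_mul hg hh]
    refine integral_congr_ae (ae_of_all _ fun ξ => ?_)
    simp only [hconj]
    ring
  rw [e1, ← integral_const_mul]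
  refine norm_integral_le_of_norm_le (hg.norm.const_mul _) (ae_of_all _ fun x => ?_)
  rw [norm_mul, mul_comm]
  refine mul_le_mul_of_nonneg_right ?_ (norm_nonneg _)
  rw [← hnorm, Real.fourier_eq']
  refine le_of_eq_of_le (congrArg norm (integral_congr_ae (ae_of_all _ fun ξ => ?_)))
    (norm_integral_gaussian_fourier_le hf'i hb (-x))
  simp only
  rw [Complex.exp_add, smul_eq_mul, inner_neg_left, real_inner_comm]
  push_cast
  ring_nf

/-- The dispersive estimate for the free time evolution. -/
lemma norm_inner_freeProp_le {f g : Space d → ℂ} (hf : Integrable f)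
    (hf2 : MemLp f 2 (volume : Measure (Space d))) (hg : Integrable g)
    (hg2 : MemLp g 2 (volume : Measure (Space d))) {t : ℝ} (ht : t ≠ 0) :
    ‖(inner ℂ (toL2 f) (freeProp t (toL2 g)) : ℂ)‖ ≤
      (4 * Real.pi * |t|)⁻¹ ^ ((d : ℝ) / 2) * (∫ y, ‖f y‖) * ∫ y, ‖g y‖ := by
  -- e^{it|k|²} with |k|² = (2π‖ξ‖)² is the boundary value at ε = 0 of the integrable Gaussian
  -- e^{-b(ε)‖ξ‖²}.
  set b : ℝ → ℂ := fun ε => 4 * Real.pi ^ 2 * (ε - Complex.I * t) with hbdef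
  have hre : ∀ ε, (b ε).re = 4 * Real.pi ^ 2 * ε := by
    intro ε
    have : b ε = ((4 * Real.pi ^ 2 : ℝ) : ℂ) * (ε - Complex.I * t) := by
      simp [hbdef]
    rw [this, Complex.re_ofReal_mul]; simp
  have him : ∀ ε, (b ε).im = -(4 * Real.pi ^ 2 * t) := by
    intro ε
    have : b ε = ((4 * Real.pi ^ 2 : ℝ) : ℂ) * (ε - Complex.I * t) := by
      simp [hbdef]
    rw [this, Complex.im_ofReal_mul]; simp
  have hlim : Tendsto (fun ε : ℝ => ∫ ξ : Space d, Complex.exp (-b ε * ‖ξ‖ ^ 2) *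
      ((𝓕 g : Space d → ℂ) ξ * starRingEnd ℂ ((𝓕 f : Space d → ℂ) ξ))) (𝓝[>] 0)
      (𝓝 (inner ℂ (toL2 f) (freeProp t (toL2 g)) : ℂ)) := by
    have e : (inner ℂ (toL2 f) (freeProp t (toL2 g)) : ℂ) = ∫ ξ : Space d,
        Complex.exp (-b 0 * ‖ξ‖ ^ 2) *
      ((𝓕 g : Space d → ℂ) ξ * starRingEnd ℂ ((𝓕 f : Space d → ℂ) ξ)) := by
      rw [freeProp_eq, inner_energyFunction (phase_bound t)]
      refine integral_congr_ae ?_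
      filter_upwards [fourier_toL2 hf hf2, fourier_toL2 hg hg2] with ξ h1 h2
      rw [h1, h2, phase]
      congr 2
      simp only [hbdef]
      push_cast
      ring
    have hint : Integrable fun ξ : Space d =>
        (𝓕 g : Space d → ℂ) ξ * starRingEnd ℂ ((𝓕 f : Space d → ℂ) ξ) := by
      refine (integrable_fourier_mul_conj (toL2 f) (toL2 g)).congr ?_
      filter_upwards [fourier_toL2 hf hf2, fourier_toL2 hg hg2] with ξ h1 h2
      rw [h1, h2]
    rw [e]
    refine tendsto_integral_filter_of_dominated_convergence
      (fun ξ => ‖(𝓕 g : Space d → ℂ) ξ * starRingEnd ℂ ((𝓕 f : Space d → ℂ) ξ)‖)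
      (Eventually.of_forall fun ε => ?_) ?_ hint.norm (ae_of_all _ fun ξ => ?_)
    · exact (Continuous.aestronglyMeasurable (by fun_prop)).mul hint.1
    · filter_upwards [self_mem_nhdsWithin] with ε hε
      refine ae_of_all _ fun ξ => ?_
      rw [norm_mul]
      refine mul_le_of_le_one_left (norm_nonneg _) ?_
      rw [Complex.norm_exp, Real.exp_le_one_iff]
      have : -b ε * (‖ξ‖ : ℂ) ^ 2 = ((‖ξ‖ ^ 2 : ℝ) : ℂ) * (-b ε) := by push_cast; ring
      rw [this, Complex.re_ofReal_mul, Complex.neg_re, hre]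
      have : (0 : ℝ) < ε := hε
      have : 0 ≤ ‖ξ‖ ^ 2 * (4 * Real.pi ^ 2 * ε) := by positivity
      linarith
    · refine Tendsto.mono_left ?_ nhdsWithin_le_nhds
      have : Continuous fun ε : ℝ => Complex.exp (-b ε * ‖ξ‖ ^ 2) *
        ((𝓕 g : Space d → ℂ) ξ * starRingEnd ℂ ((𝓕 f : Space d → ℂ) ξ)) := by
        simp only [hbdef]; fun_prop
      exact this.tendsto 0
  refine le_of_tendsto hlim.norm ?_
  filter_upwards [self_mem_nhdsWithin] with ε hε
  have hε' : (0 : ℝ) < ε := hε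
  have hb : 0 < (b ε).re := by rw [hre]; positivity
  refine (norm_integral_gaussian_fourier_fourier_le hf hg hb).trans ?_
  -- |b| ≥ |Im b| uniformly in ε, whence π/|b| ≤ 1/(4π|t|).
  have hb1 : 4 * Real.pi ^ 2 * |t| ≤ ‖b ε‖ := by
    have := Complex.abs_im_le_norm (b ε)
    rwa [him, abs_neg, abs_mul, abs_of_pos (by positivity : 0 < 4 * Real.pi ^ 2)] at this
  have ht' : 0 < |t| := abs_pos.2 ht
  gcongr
  rw [div_le_iff₀ (lt_of_lt_of_le (by positivity) hb1), ← div_eq_inv_mul, le_div_iff₀ (by positivity)]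
  refine le_trans (le_of_eq ?_) hb1
  ring

/-! ### Norms of the Hermite functions. -/

open Polynomial in
/-- The polynomial `p` with `(d/dx)^q e^{-x²} = p(x) e^{-x²}`. -/
noncomputable def gaussPoly : ℕ → ℝ[X]
  | 0 => 1
  | q + 1 => derivative (gaussPoly q) - C 2 * X * gaussPoly q

lemma hasDerivAt_eval_mul_gaussian (P : Polynomial ℝ) (x : ℝ) :
    HasDerivAt (fun y => P.eval y * Real.exp (-y ^ 2))
      ((P.derivative - Polynomial.C 2 * Polynomial.X * P).eval x * Real.exp (-x ^ 2)) x := by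
  have h1 : HasDerivAt (fun y : ℝ => Real.exp (-y ^ 2)) (Real.exp (-x ^ 2) * (-(2 * x))) x := by
    have := ((hasDerivAt_pow 2 x).fun_neg).exp
    simpa using this
  refine ((P.hasDerivAt x).mul h1).congr_deriv ?_
  simp only [Polynomial.eval_sub, Polynomial.eval_mul, Polynomial.eval_C, Polynomial.eval_X]
  ring

lemma iteratedDeriv_gaussian (q : ℕ) :
    iteratedDeriv q (fun y : ℝ => Real.exp (-y ^ 2)) =
      fun x => (gaussPoly q).eval x * Real.exp (-x ^ 2) := by
  induction q with
  | zero => simp [gaussPoly]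
  | succ q ih =>
    rw [iteratedDeriv_succ, ih]
    funext x
    exact (hasDerivAt_eval_mul_gaussian _ x).deriv

/-- As `gaussPoly q` is (-1)^q H_q, this is the lowering relation H_{q+1}' = 2(q+1) H_q. -/
lemma derivative_gaussPoly_succ (q : ℕ) :
    (gaussPoly (q + 1)).derivative = Polynomial.C (-2 * ((q : ℝ) + 1)) * gaussPoly q := by
  induction q with
  | zero => simp [gaussPoly]
  | succ q ih =>
    conv_lhs => rw [gaussPoly, Polynomial.derivative_sub, ih]
    conv_rhs => rw [gaussPoly]
    simp only [Polynomial.derivative_mul, Polynomial.derivative_C, Polynomial.derivative_X, ih]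
    have e : gaussPoly (q + 1) = Polynomial.derivative (gaussPoly q) -
      Polynomial.C 2 * Polynomial.X * gaussPoly q := rfl
    rw [e]
    push_cast
    simp only [map_mul, map_add, map_neg, map_one]
    ring

lemma integrable_eval_mul_gaussian (P : Polynomial ℝ) {b : ℝ} (hb : 0 < b) :
    Integrable fun x : ℝ => P.eval x * Real.exp (-b * x ^ 2) := by
  induction P using Polynomial.induction_on' with
  | add p q hp hq =>
    simpa only [Polynomial.eval_add, add_mul] using! hp.add hq
  | monomial n a =>
    have := (integrable_rpow_mul_exp_neg_mul_sq hb (s := (n : ℝ))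
      (by have : (0 : ℝ) ≤ n := n.cast_nonneg
          linarith)).const_mul a
    simpa only [Polynomial.eval_monomial, Real.rpow_natCast, mul_assoc] using this

lemma integrable_eval_mul_gaussian_one (P : Polynomial ℝ) :
    Integrable fun x : ℝ => P.eval x * Real.exp (-x ^ 2) := by
  simpa using integrable_eval_mul_gaussian P one_pos

/-- The integral of a polynomial with respect to the Gaussian weight. -/
noncomputable def gaussInt (P : Polynomial ℝ) : ℝ := ∫ x : ℝ, P.eval x * Real.exp (-x ^ 2)

lemma gaussInt_add (P Q : Polynomial ℝ) : gaussInt (P + Q) = gaussInt P + gaussInt Q := by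
  rw [gaussInt, gaussInt, gaussInt, ← integral_add (integrable_eval_mul_gaussian_one P)
    (integrable_eval_mul_gaussian_one Q)]
  simp only [Polynomial.eval_add, add_mul]

lemma gaussInt_C_mul (a : ℝ) (P : Polynomial ℝ) :
    gaussInt (Polynomial.C a * P) = a * gaussInt P := by
  rw [gaussInt, gaussInt, ← integral_const_mul]
  simp only [Polynomial.eval_mul, Polynomial.eval_C, mul_assoc]

lemma gaussInt_mono {P Q : Polynomial ℝ} (h : ∀ x, P.eval x ≤ Q.eval x) :
    gaussInt P ≤ gaussInt Q :=
  integral_mono (integrable_eval_mul_gaussian_one P) (integrable_eval_mul_gaussian_one Q)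
    fun x => mul_le_mul_of_nonneg_right (h x) (Real.exp_pos _).le

/-- Since p_{q+1} e^{-x²} is the derivative of p_q e^{-x²}, one integration by parts and the
lowering relation give the recursion. -/
lemma gaussInt_gaussPoly_sq_succ (q : ℕ) :
    gaussInt (gaussPoly (q + 1) ^ 2) = 2 * (q + 1) * gaussInt (gaussPoly q ^ 2) := by
  have e1 : gaussInt (gaussPoly (q + 1) ^ 2) = ∫ x : ℝ, (gaussPoly (q + 1)).eval x *
      ((gaussPoly (q + 1)).eval x * Real.exp (-x ^ 2)) := by
    refine integral_congr_ae (ae_of_all _ fun x => ?_)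
    simp only [Polynomial.eval_pow]
    ring
  have key := integral_mul_deriv_eq_deriv_mul_of_integrable
    (u := fun x => (gaussPoly (q + 1)).eval x)
    (u' := fun x => (gaussPoly (q + 1)).derivative.eval x)
    (v := fun x => (gaussPoly q).eval x * Real.exp (-x ^ 2))
    (v' := fun x => (gaussPoly (q + 1)).eval x * Real.exp (-x ^ 2))
    (fun x _ => (gaussPoly (q + 1)).hasDerivAt x)
    (fun x _ => hasDerivAt_eval_mul_gaussian (gaussPoly q) x)
    (by simpa [Pi.mul_def, mul_assoc] using
      integrable_eval_mul_gaussian_one (gaussPoly (q + 1) * gaussPoly (q + 1)))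
    (by simpa [Pi.mul_def, mul_assoc] using
      integrable_eval_mul_gaussian_one ((gaussPoly (q + 1)).derivative * gaussPoly q))
    (by simpa [Pi.mul_def, mul_assoc] using
      integrable_eval_mul_gaussian_one (gaussPoly (q + 1) * gaussPoly q))
  rw [e1, key, derivative_gaussPoly_succ, gaussInt, ← integral_const_mul, ← integral_neg]
  refine integral_congr_ae (ae_of_all _ fun x => ?_)
  simp only [Polynomial.eval_mul, Polynomial.eval_C, Polynomial.eval_pow]
  ring

lemma gaussInt_gaussPoly_sq (q : ℕ) :
    gaussInt (gaussPoly q ^ 2) = 2 ^ q * (q.factorial : ℝ) * Real.sqrt Real.pi := by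
  induction q with
  | zero =>
    have := integral_gaussian 1
    simpa [gaussPoly, gaussInt] using this
  | succ q ih =>
    rw [gaussInt_gaussPoly_sq_succ, ih, Nat.factorial_succ]
    push_cast
    ring

lemma gaussInt_derivative_sq (q : ℕ) :
    gaussInt ((gaussPoly q).derivative ^ 2) = 2 * q * gaussInt (gaussPoly q ^ 2) := by
  cases q with
  | zero => simp [gaussPoly, gaussInt]
  | succ q =>
    rw [derivative_gaussPoly_succ, gaussInt_gaussPoly_sq_succ, mul_pow, ← Polynomial.C_pow,
      gaussInt_C_mul]
    push_cast
    ring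

/-- From p_{q+1} = p_q' - 2x p_q follows ½(p_{q+1}² + p_q'²) = (p_q' - x p_q)² + x² p_q². The true
ratio is q + 1/2; the cruder bound is enough. -/
lemma gaussInt_X_sq_mul_le (q : ℕ) :
    gaussInt (Polynomial.X ^ 2 * gaussPoly q ^ 2) ≤ (2 * q + 1) * gaussInt (gaussPoly q ^ 2) := by
  have h : gaussInt (Polynomial.X ^ 2 * gaussPoly q ^ 2) ≤ gaussInt (Polynomial.C (1 / 2) *
      (gaussPoly (q + 1) ^ 2 + (gaussPoly q).derivative ^ 2)) := by
    refine gaussInt_mono fun x => ?_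
    have e : (gaussPoly (q + 1)).eval x = (gaussPoly q).derivative.eval x -
        2 * x * (gaussPoly q).eval x := by
      rw [gaussPoly]; simp
    simp only [Polynomial.eval_mul, Polynomial.eval_add, Polynomial.eval_pow, Polynomial.eval_X,
      Polynomial.eval_C, e]
    nlinarith [sq_nonneg ((gaussPoly q).derivative.eval x - x * (gaussPoly q).eval x)]
  refine h.trans (le_of_eq ?_)
  rw [gaussInt_C_mul, gaussInt_add, gaussInt_derivative_sq, gaussInt_gaussPoly_sq_succ]
  ring

lemma hermiteFun_eq (q : ℕ) (x : ℝ) :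
    hermiteFun q x = (-1) ^ q / (Real.sqrt (2 ^ q * (q.factorial : ℝ)) * Real.pi ^ (1 / 4 : ℝ)) *
      ((gaussPoly q).eval x * Real.exp (-(1 / 2) * x ^ 2)) := by
  rw [hermiteFun, iteratedDeriv_gaussian, mul_assoc]
  congr 1
  have : Real.exp (-(1 / 2) * x ^ 2) = Real.exp (x ^ 2 / 2) * Real.exp (-x ^ 2) := by
    rw [← Real.exp_add]; ring_nf
  rw [this]; ring

lemma integrable_hermiteFun (q : ℕ) : Integrable (hermiteFun q) := by
  rw [show hermiteFun q = _ from funext (hermiteFun_eq q)]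
  exact (integrable_eval_mul_gaussian _ (by norm_num)).const_mul _

lemma hermiteFun_sq (q : ℕ) (x : ℝ) : hermiteFun q x ^ 2 =
    (gaussInt (gaussPoly q ^ 2))⁻¹ * ((gaussPoly q ^ 2).eval x * Real.exp (-x ^ 2)) := by
  rw [hermiteFun_eq, gaussInt_gaussPoly_sq, mul_pow, mul_pow, div_pow, mul_pow, ← pow_mul,
    mul_comm q 2, pow_mul, neg_one_sq, one_pow, Real.sq_sqrt (by positivity), ← Real.exp_nat_mul,
    Polynomial.eval_pow, ← Real.rpow_natCast (Real.pi ^ (1 / 4 : ℝ)), ← Real.rpow_mul Real.pi_pos.le,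
    Real.sqrt_eq_rpow, one_div]
  norm_num
  ring_nf
  simp

lemma gaussInt_gaussPoly_sq_pos (q : ℕ) : 0 < gaussInt (gaussPoly q ^ 2) := by
  rw [gaussInt_gaussPoly_sq]
  have := Real.pi_pos
  positivity

lemma integrable_hermiteFun_sq (q : ℕ) : Integrable fun x => hermiteFun q x ^ 2 := by
  simp only [hermiteFun_sq]
  exact (integrable_eval_mul_gaussian_one _).const_mul _

lemma integral_hermiteFun_sq (q : ℕ) : ∫ x, hermiteFun q x ^ 2 = 1 := by
  simp only [hermiteFun_sq]
  rw [integral_const_mul]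
  exact inv_mul_cancel₀ (gaussInt_gaussPoly_sq_pos q).ne'

/-- With a = √(q+1), the arithmetic-geometric mean gives |φ| ≤ ½(a/(1+x²) + (1+x²)φ²/a). The two
terms integrate to at most πa/2 and a, and π ≤ 4. -/
lemma integral_abs_hermiteFun_le (q : ℕ) :
    ∫ x, |hermiteFun q x| ≤ 3 * Real.sqrt (q + 1) := by
  set a := Real.sqrt (q + 1) with ha
  have hq : (0 : ℝ) ≤ q := q.cast_nonneg
  have ha0 : 0 < a := Real.sqrt_pos.2 (by linarith)
  have ha2 : a ^ 2 = q + 1 := Real.sq_sqrt (by linarith)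
  set P : Polynomial ℝ := gaussPoly q ^ 2 + Polynomial.X ^ 2 * gaussPoly q ^ 2 with hP
  set N := gaussInt (gaussPoly q ^ 2) with hN
  have hNpos : 0 < N := gaussInt_gaussPoly_sq_pos q
  have hpt : ∀ x, |hermiteFun q x| ≤ 1 / 2 * (a * (1 + x ^ 2)⁻¹) +
      1 / 2 * (a⁻¹ * N⁻¹ * (P.eval x * Real.exp (-x ^ 2))) := by
    intro x
    have e : N⁻¹ * (P.eval x * Real.exp (-x ^ 2)) = (1 + x ^ 2) * |hermiteFun q x| ^ 2 := by
      rw [sq_abs, hermiteFun_sq, hP]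
      simp only [Polynomial.eval_add, Polynomial.eval_mul, Polynomial.eval_pow, Polynomial.eval_X]
      ring
    rw [mul_assoc a⁻¹, e]
    have hx : 0 < 1 + x ^ 2 := by positivity
    have h1 : 0 ≤ (a⁻¹ * (1 + x ^ 2)⁻¹) * (a - (1 + x ^ 2) * |hermiteFun q x|) ^ 2 := by positivity
    have h2 : (a⁻¹ * (1 + x ^ 2)⁻¹) * (a - (1 + x ^ 2) * |hermiteFun q x|) ^ 2 =
        a * (1 + x ^ 2)⁻¹ + a⁻¹ * ((1 + x ^ 2) * |hermiteFun q x| ^ 2) - 2 * |hermiteFun q x| := by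
      field_simp
      ring
    rw [h2] at h1
    linarith
  have hi1 : Integrable fun x : ℝ => 1 / 2 * (a * (1 + x ^ 2)⁻¹) :=
    (integrable_inv_one_add_sq.const_mul a).const_mul _
  have hi2 : Integrable fun x : ℝ => 1 / 2 * (a⁻¹ * N⁻¹ * (P.eval x * Real.exp (-x ^ 2))) :=
    ((integrable_eval_mul_gaussian_one P).const_mul _).const_mul _
  refine (integral_mono (integrable_hermiteFun q).abs (hi1.add hi2) hpt).trans ?_
  simp only [Pi.add_apply]
  rw [integral_add hi1 hi2, integral_const_mul, integral_const_mul, integral_const_mul,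
    integral_const_mul, integral_univ_inv_one_add_sq]
  have hPle : (∫ x : ℝ, P.eval x * Real.exp (-x ^ 2)) ≤ (2 * q + 2) * N := by
    change gaussInt P ≤ _
    rw [hP, gaussInt_add]
    have := gaussInt_X_sq_mul_le q
    linarith
  have h3 : a⁻¹ * N⁻¹ * (∫ x : ℝ, P.eval x * Real.exp (-x ^ 2)) ≤ 2 * a := by
    refine (mul_le_mul_of_nonneg_left hPle (by positivity)).trans (le_of_eq ?_)
    rw [show (2 * (q : ℝ) + 2) = 2 * a ^ 2 by rw [ha2]; ring]
    field_simp
  have := Real.pi_le_four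
  nlinarith

/-- The square root of the weight which bounds the norms of the Hermite functions. -/
noncomputable def hermiteBound (q : Fin d → ℕ) : ℝ := ∏ i, (3 * Real.sqrt ((q i : ℝ) + 1))

lemma one_le_hermiteBound (q : Fin d → ℕ) : 1 ≤ hermiteBound q := by
  refine Finset.prod_const_one.symm.trans_le
    (Finset.prod_le_prod (fun i _ => zero_le_one) fun i _ => ?_)
  have : 1 ≤ Real.sqrt ((q i : ℝ) + 1) := by
    rw [Real.one_le_sqrt]; linarith [(q i).cast_nonneg (α := ℝ)]
  linarith

lemma hermiteBound_pos (q : Fin d → ℕ) : 0 < hermiteBound q :=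
  one_pos.trans_le (one_le_hermiteBound q)

lemma integrable_space_prod {f : Fin d → ℝ → ℝ} (hf : ∀ i, Integrable (f i)) :
    Integrable fun x : Space d => ∏ i, f i (x i) :=
  ((PiLp.volume_preserving_ofLp (Fin d)).integrable_comp_emb
    (MeasurableEquiv.toLp 2 (Fin d → ℝ)).symm.measurableEmbedding).2 (Integrable.fintype_prod hf)

lemma integral_space_prod (f : Fin d → ℝ → ℝ) :
    ∫ x : Space d, ∏ i, f i (x i) = ∏ i, ∫ x, f i x := by
  rw [← integral_fintype_prod_volume_eq_prod]
  exact (PiLp.volume_preserving_ofLp (Fin d)).integral_comp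
    (MeasurableEquiv.toLp 2 (Fin d → ℝ)).symm.measurableEmbedding (fun y => ∏ i, f i (y i))

lemma integrable_hermiteFunD (q : Fin d → ℕ) :
    Integrable fun x : Space d => (hermiteFunD q x : ℂ) :=
  (integrable_space_prod fun i => integrable_hermiteFun (q i)).ofReal

lemma integral_norm_hermiteFunD_le (q : Fin d → ℕ) :
    ∫ x : Space d, ‖(hermiteFunD q x : ℂ)‖ ≤ hermiteBound q := by
  simp only [Complex.norm_real, Real.norm_eq_abs, hermiteFunD, Finset.abs_prod]
  rw [integral_space_prod (fun i x => |hermiteFun (q i) x|)]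
  exact Finset.prod_le_prod (fun i _ => integral_nonneg fun x => abs_nonneg _)
    fun i _ => integral_abs_hermiteFun_le _

lemma norm_hermiteFunD_sq (q : Fin d → ℕ) (x : Space d) :
    ‖(hermiteFunD q x : ℂ)‖ ^ 2 = ∏ i, hermiteFun (q i) (x i) ^ 2 := by
  rw [Complex.norm_real, Real.norm_eq_abs, sq_abs, hermiteFunD, Finset.prod_pow]

lemma memLp_hermiteFunD (q : Fin d → ℕ) :
    MemLp (fun x : Space d => (hermiteFunD q x : ℂ)) 2 (volume : Measure (Space d)) := by
  rw [memLp_two_iff_integrable_sq_norm (integrable_hermiteFunD q).1]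
  simp only [norm_hermiteFunD_sq]
  exact integrable_space_prod fun i => integrable_hermiteFun_sq (q i)

/-- The basis of Hermite functions in `L²(ℝ^d)`. -/
noncomputable def mode (q : Fin d → ℕ) : OneParticle d := toL2 fun x => (hermiteFunD q x : ℂ)

lemma norm_mode (q : Fin d → ℕ) : ‖mode q‖ = 1 := by
  have h : (inner ℂ (mode q) (mode q) : ℂ) = 1 := by
    rw [L2.inner_def, show (1 : ℂ) = ((∫ x : Space d, ∏ i, hermiteFun (q i) (x i) ^ 2 : ℝ) : ℂ) by
      rw [integral_space_prod (fun i x => hermiteFun (q i) x ^ 2)]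
      simp [integral_hermiteFun_sq], ← integral_complex_ofReal]
    refine integral_congr_ae ?_
    filter_upwards [coeFn_toL2 (memLp_hermiteFunD q)] with x hx
    rw [mode, hx, inner_self_eq_norm_sq_to_K, ← norm_hermiteFunD_sq]
    push_cast
    rfl
  rw [inner_self_eq_norm_sq_to_K] at h
  have h1 : ((‖mode q‖ ^ 2 : ℝ) : ℂ) = 1 := by simpa using! h
  have h2 : ‖mode q‖ ^ 2 = 1 := by exact_mod_cast h1
  exact (pow_eq_one_iff_of_nonneg (norm_nonneg _) two_ne_zero).1 h2

/-! ### Integrable time decay between Hermite modes. -/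

/-- An integrable function of time bounding the decay of correlations. -/
noncomputable def decay (t : ℝ) : ℝ := 4 * (1 + ‖t‖) ^ (-(3 / 2 : ℝ))

lemma integrable_decay : Integrable decay :=
  (integrable_one_add_norm (E := ℝ) (μ := volume) (r := 3 / 2) (by norm_num)).const_mul 4

lemma decay_neg (t : ℝ) : decay (-t) = decay t := by simp [decay]

lemma decay_nonneg (t : ℝ) : 0 ≤ decay t := by unfold decay; positivity

lemma tendsto_decay_atTop : Tendsto decay atTop (𝓝 0) := by
  have h : Tendsto (fun t : ℝ => 1 + ‖t‖) atTop atTop :=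
    tendsto_atTop_add_const_left _ _ tendsto_norm_atTop_atTop
  have := ((tendsto_rpow_neg_atTop (by norm_num : (0 : ℝ) < 3 / 2)).comp h).const_mul 4
  simpa [decay, Function.comp_def] using! this

/-- This is where d ≥ 3 enters, through d/2 ≥ 3/2 > 1. For |t| ≤ 1 Cauchy–Schwarz suffices; for |t|
> 1 the dispersive estimate applies, with 1 + |t| ≤ 2|t|. The factor 4 ≥ 2^{3/2} in `decay` covers
both ranges. -/
lemma norm_inner_mode_freeProp_le (hd : 3 ≤ d) (q q' : Fin d → ℕ) (t : ℝ) :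
    ‖(inner ℂ (mode q) (freeProp t (mode q')) : ℂ)‖ ≤
      decay t * (hermiteBound q * hermiteBound q') := by
  have hB := one_le_hermiteBound q
  have hB' := one_le_hermiteBound q'
  have hd' : (3 / 2 : ℝ) ≤ (d : ℝ) / 2 := by
    have : (3 : ℝ) ≤ d := by exact_mod_cast hd
    linarith
  have h2 : (2 : ℝ) ^ (3 / 2 : ℝ) ≤ 4 := by
    calc (2 : ℝ) ^ (3 / 2 : ℝ) ≤ 2 ^ (2 : ℝ) :=
          Real.rpow_le_rpow_of_exponent_le (by norm_num) (by norm_num)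
      _ = 4 := by norm_num
  have hp : (1 + ‖t‖) ^ (-(3 / 2 : ℝ)) = ((1 + ‖t‖) ^ (3 / 2 : ℝ))⁻¹ :=
    Real.rpow_neg (by positivity) _
  rcases le_or_gt |t| 1 with ht | ht
  · have h1 : ‖(inner ℂ (mode q) (freeProp t (mode q')) : ℂ)‖ ≤ 1 := by
      refine (norm_inner_le_norm _ _).trans ?_
      rw [norm_freeProp, norm_mode, norm_mode, one_mul]
    have h3 : 1 ≤ decay t := by
      have : (1 + ‖t‖) ^ (3 / 2 : ℝ) ≤ 2 ^ (3 / 2 : ℝ) :=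
        Real.rpow_le_rpow (by positivity) (by rw [Real.norm_eq_abs]; linarith) (by norm_num)
      have h4 : (1 + ‖t‖) ^ (3 / 2 : ℝ) ≤ 4 := this.trans h2
      rw [decay, hp, ← div_eq_mul_inv, le_div_iff₀ (by positivity)]
      linarith
    exact h1.trans (one_le_mul_of_one_le_of_one_le h3 (one_le_mul_of_one_le_of_one_le hB hB'))
  · have ht0 : t ≠ 0 := by rintro rfl; simp at ht; linarith
    refine (norm_inner_freeProp_le (integrable_hermiteFunD q) (memLp_hermiteFunD q)
      (integrable_hermiteFunD q') (memLp_hermiteFunD q') ht0).trans ?_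
    rw [mul_assoc]
    have hpi : 1 ≤ 4 * Real.pi := by linarith [Real.two_le_pi]
    have h5 : (4 * Real.pi * |t|)⁻¹ ^ ((d : ℝ) / 2) ≤ decay t := by
      have h6 : (4 * Real.pi * |t|)⁻¹ ≤ |t|⁻¹ := by
        gcongr
        nlinarith
      have h7 : (4 * Real.pi * |t|)⁻¹ ^ ((d : ℝ) / 2) ≤ (|t|⁻¹) ^ (3 / 2 : ℝ) :=
        (Real.rpow_le_rpow (by positivity) h6 (by linarith)).trans
          (Real.rpow_le_rpow_of_exponent_ge (by positivity) (inv_le_one_of_one_le₀ ht.le) hd')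
      refine h7.trans ?_
      rw [decay, hp, Real.inv_rpow (abs_nonneg _), ← div_eq_mul_inv, le_div_iff₀ (by positivity),
        inv_mul_le_iff₀ (by positivity), mul_comm]
      have : (1 + ‖t‖) ^ (3 / 2 : ℝ) ≤ (2 * |t|) ^ (3 / 2 : ℝ) :=
        Real.rpow_le_rpow (by positivity) (by rw [Real.norm_eq_abs]; linarith) (by norm_num)
      rw [Real.mul_rpow (by norm_num) (abs_nonneg _)] at this
      exact this.trans (mul_le_mul_of_nonneg_right h2 (by positivity))
    exact mul_le_mul h5 (mul_le_mul (integral_norm_hermiteFunD_le q)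
      (integral_norm_hermiteFunD_le q') (integral_nonneg fun _ => norm_nonneg _)
      (hermiteBound_pos q).le) (mul_nonneg (integral_nonneg fun _ => norm_nonneg _)
      (integral_nonneg fun _ => norm_nonneg _)) (decay_nonneg t)

/-! ### From the weighted Sobolev norm to weighted ℓ¹ coefficients. -/

lemma summable_prod_fin {g : ℕ → ℝ} (hg : Summable g) (h0 : ∀ n, 0 ≤ g n) (n : ℕ) :
    Summable fun q : Fin n → ℕ => ∏ i, g (q i) := by
  induction n with
  | zero => exact (hasSum_fintype _).summable
  | succ n ih =>
    rw [← (Fin.consEquiv fun _ : Fin (n + 1) => ℕ).summable_iff]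
    have := hg.mul_of_nonneg ih h0 fun q => Finset.prod_nonneg fun i _ => h0 _
    simpa [Function.comp_def, Fin.prod_univ_succ, Fin.consEquiv] using this

lemma hermiteBound_sq (q : Fin d → ℕ) : hermiteBound q ^ 2 = ∏ i, (9 * ((q i : ℝ) + 1)) := by
  rw [hermiteBound, ← Finset.prod_pow]
  refine Finset.prod_congr rfl fun i _ => ?_
  rw [mul_pow, Real.sq_sqrt (by positivity)]
  norm_num

lemma summable_hermiteBound_sq_div :
    Summable fun q : Fin d → ℕ => hermiteBound q ^ 2 / ∏ i, ((q i : ℝ) + 1) ^ 3 := by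
  have h : Summable fun n : ℕ => 9 * (1 / ((n + 1 : ℕ) : ℝ) ^ 2) :=
    ((summable_nat_add_iff 1).2 (Real.summable_one_div_nat_pow.2 one_lt_two)).mul_left 9
  refine (summable_prod_fin h (fun n => by positivity) d).congr fun q => ?_
  rw [hermiteBound_sq, ← Finset.prod_div_distrib]
  refine Finset.prod_congr rfl fun i _ => ?_
  have : (q i : ℝ) + 1 ≠ 0 := by positivity
  push_cast
  field_simp

instance : Fintype Reservoir := ⟨{Reservoir.I, Reservoir.II}, fun r => by cases r <;> simp⟩

/-- A one-particle mode: a reservoir and a Hermite function. -/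
abbrev Mode (d : ℕ) : Type := Reservoir × (Fin d → ℕ)

/-- The Hermite coefficients of a one-body kernel. -/
noncomputable def kernelCoeff (w : Kernel d 1) (p : Mode d × Mode d) : ℂ :=
  w.coeff (fun _ => p.1.1) (fun _ => p.2.1) (fun _ => p.1.2) (fun _ => p.2.2)

/-- The weight of a pair of modes. -/
noncomputable def pairWeight (p : Mode d × Mode d) : ℝ := hermiteBound p.1.2 * hermiteBound p.2.2

lemma one_le_pairWeight (p : Mode d × Mode d) : 1 ≤ pairWeight p :=
  one_le_mul_of_one_le_of_one_le (one_le_hermiteBound _) (one_le_hermiteBound _)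

lemma pairWeight_nonneg (p : Mode d × Mode d) : 0 ≤ pairWeight p :=
  zero_le_one.trans (one_le_pairWeight p)

/-- Coefficients which are summable with the weight of the Hermite functions. -/
def Tame (c : Mode d × Mode d → ℂ) : Prop := Summable fun p => ‖c p‖ * pairWeight p

/-- The weighted `ℓ¹` norm of the coefficients. -/
noncomputable def tameNorm (c : Mode d × Mode d → ℂ) : ℝ := ∑' p, ‖c p‖ * pairWeight p

lemma tameNorm_nonneg (c : Mode d × Mode d → ℂ) : 0 ≤ tameNorm c :=
  tsum_nonneg fun p => mul_nonneg (norm_nonneg _) (pairWeight_nonneg p)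

lemma Tame.mono {c c' : Mode d × Mode d → ℂ} (hc : Tame c) {C : ℝ} (h : ∀ p, ‖c' p‖ ≤ C * ‖c p‖) :
    Tame c' := by
  refine Summable.of_nonneg_of_le (fun p => mul_nonneg (norm_nonneg _) (pairWeight_nonneg p))
    (fun p => ?_) (hc.mul_left C)
  rw [← mul_assoc]
  exact mul_le_mul_of_nonneg_right (h p) (pairWeight_nonneg p)

lemma Tame.summable_norm {c : Mode d × Mode d → ℂ} (hc : Tame c) : Summable fun p => ‖c p‖ :=
  hc.of_nonneg_of_le (fun _ => norm_nonneg _)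
    fun p => le_mul_of_one_le_right (norm_nonneg _) (one_le_pairWeight p)

/-- For x the modulus of a coefficient, B its pair weight and P, P' the cubic weights of the norm,
2xB ≤ PP'x² + B²/(PP'). The first term is summable by assumption; the second is a product of factors
9/(q+1)², which is why the third power in the norm suffices. -/
lemma Kernel.HasFiniteNorm.tame {w : Kernel d 1} (hw : w.HasFiniteNorm) :
    Tame (kernelCoeff w) := by
  have hcomp : ∀ rr : Reservoir × Reservoir, Summable fun q : (Fin d → ℕ) × (Fin d → ℕ) =>
      ‖kernelCoeff w ((rr.1, q.1), (rr.2, q.2))‖ * (hermiteBound q.1 * hermiteBound q.2) := by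
    intro rr
    have h1 := (hw (fun _ => rr.1) (fun _ => rr.2)).2
    rw [← (((Equiv.funUnique (Fin 1) (Fin d → ℕ)).symm.prodCongr
      (Equiv.funUnique (Fin 1) (Fin d → ℕ)).symm)).summable_iff] at h1
    have h2 := (summable_hermiteBound_sq_div (d := d)).mul_of_nonneg
      (summable_hermiteBound_sq_div (d := d))
      (fun q => by positivity) (fun q => by positivity)
    refine Summable.of_nonneg_of_le (fun q => mul_nonneg (norm_nonneg _) (mul_nonneg
      (hermiteBound_pos _).le (hermiteBound_pos _).le)) (fun q => ?_) (h1.add h2)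
    set P : ℝ := ∏ i, ((q.1 i : ℝ) + 1) ^ 3 with hP
    set P' : ℝ := ∏ i, ((q.2 i : ℝ) + 1) ^ 3 with hP'
    have hP0 : 0 < P := Finset.prod_pos fun i _ => by positivity
    have hP0' : 0 < P' := Finset.prod_pos fun i _ => by positivity
    set x := ‖kernelCoeff w ((rr.1, q.1), (rr.2, q.2))‖ with hx
    have e : ((fun Q : (Fin 1 → Fin d → ℕ) × (Fin 1 → Fin d → ℕ) =>
        (∏ j, ∏ i, ((Q.1 j i : ℝ) + 1) ^ 3 * ((Q.2 j i : ℝ) + 1) ^ 3) *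
        ‖w.coeff (fun _ => rr.1) (fun _ => rr.2) Q.1 Q.2‖ ^ 2) ∘
        ((Equiv.funUnique (Fin 1) (Fin d → ℕ)).symm.prodCongr
      (Equiv.funUnique (Fin 1) (Fin d → ℕ)).symm)) q = P * P' * x ^ 2 := by
      simp only [Function.comp_apply, Equiv.prodCongr_apply, Prod.map, Finset.univ_unique,
        Finset.prod_singleton, Finset.prod_mul_distrib]
      rfl
    rw [e]
    have h3 : 0 ≤ (P * P')⁻¹ * (P * P' * x - hermiteBound q.1 * hermiteBound q.2) ^ 2 := by
      positivity
    have h4 : (P * P')⁻¹ * (P * P' * x - hermiteBound q.1 * hermiteBound q.2) ^ 2 =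
        P * P' * x ^ 2 + hermiteBound q.1 ^ 2 / P * (hermiteBound q.2 ^ 2 / P') -
          2 * (x * (hermiteBound q.1 * hermiteBound q.2)) := by
      field_simp
      ring
    have h5 : 0 ≤ x * (hermiteBound q.1 * hermiteBound q.2) := mul_nonneg (norm_nonneg _)
      (mul_nonneg (hermiteBound_pos _).le (hermiteBound_pos _).le)
    linarith
  have h6 : Summable fun z : (Reservoir × Reservoir) × ((Fin d → ℕ) × (Fin d → ℕ)) =>
      ‖kernelCoeff w ((z.1.1, z.2.1), (z.1.2, z.2.2))‖ *
        (hermiteBound z.2.1 * hermiteBound z.2.2) := by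
    rw [summable_prod_of_nonneg fun z => mul_nonneg (norm_nonneg _) (mul_nonneg
      (hermiteBound_pos _).le (hermiteBound_pos _).le)]
    exact ⟨hcomp, (hasSum_fintype _).summable⟩
  rw [Tame, ← (Equiv.prodProdProdComm Reservoir Reservoir (Fin d → ℕ) (Fin d → ℕ)).summable_iff]
  exact h6

/-! ### Sesquilinear forms of one-body operators. -/

section Form

/-- The overlap of a vector of reservoir `r` with a mode. -/
noncomputable def overlap (r : Reservoir) (f : OneParticle d) (i : Mode d) : ℂ :=
  if i.1 = r then inner ℂ f (mode i.2) else 0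

lemma norm_overlap_le (r : Reservoir) (f : OneParticle d) (i : Mode d) :
    ‖overlap r f i‖ ≤ ‖f‖ := by
  unfold overlap
  split_ifs
  · exact (norm_inner_le_norm _ _).trans (by rw [norm_mode, mul_one])
  · simp

/-- The sesquilinear form `⟨f, c_{rs} g⟩` of the component `r, s` of the operator with Hermite
coefficients `c`. -/
noncomputable def form (c : Mode d × Mode d → ℂ) (r s : Reservoir) (f g : OneParticle d) : ℂ :=
  ∑' p, c p * (overlap r f p.1 * starRingEnd ℂ (overlap s g p.2))

lemma norm_form_term_le (c : Mode d × Mode d → ℂ) (r s : Reservoir) (f g : OneParticle d)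
    (p : Mode d × Mode d) :
    ‖c p * (overlap r f p.1 * starRingEnd ℂ (overlap s g p.2))‖ ≤
      ‖c p‖ * pairWeight p * (‖f‖ * ‖g‖) := by
  rw [norm_mul, norm_mul, RCLike.norm_conj]
  refine mul_le_mul (le_mul_of_one_le_right (norm_nonneg _) (one_le_pairWeight p))
    (mul_le_mul (norm_overlap_le _ _ _) (norm_overlap_le _ _ _) (norm_nonneg _) (norm_nonneg _))
    (by positivity) (mul_nonneg (norm_nonneg _) (pairWeight_nonneg p))

lemma Tame.summable_form {c : Mode d × Mode d → ℂ} (hc : Tame c) (r s : Reservoir)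
    (f g : OneParticle d) :
    Summable fun p => c p * (overlap r f p.1 * starRingEnd ℂ (overlap s g p.2)) :=
  Summable.of_norm_bounded (hc.mul_right _) (norm_form_term_le c r s f g)

lemma Tame.norm_form_le {c : Mode d × Mode d → ℂ} (hc : Tame c) (r s : Reservoir)
    (f g : OneParticle d) : ‖form c r s f g‖ ≤ tameNorm c * ‖f‖ * ‖g‖ := by
  rw [mul_assoc, tameNorm, ← tsum_mul_right]
  exact tsum_of_norm_bounded (hc.mul_right _).hasSum (norm_form_term_le c r s f g)

lemma overlap_add (r : Reservoir) (f f' : OneParticle d) (i : Mode d) :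
    overlap r (f + f') i = overlap r f i + overlap r f' i := by
  unfold overlap; split_ifs <;> simp [inner_add_left]

lemma overlap_real_smul (r : Reservoir) (a : ℝ) (f : OneParticle d) (i : Mode d) :
    overlap r (a • f) i = a * overlap r f i := by
  have : a • f = (a : ℂ) • f := rfl
  unfold overlap
  rw [this]
  split_ifs <;> simp

/-- The form as a bounded real bilinear map. -/
lemma Tame.exists_bilin {c : Mode d × Mode d → ℂ} (hc : Tame c) (r s : Reservoir) :
    ∃ b : OneParticle d →L[ℝ] OneParticle d →L[ℝ] ℂ, ∀ f g, b f g = form c r s f g := by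
  refine ⟨LinearMap.mkContinuous₂ (LinearMap.mk₂ ℝ (form c r s) ?_ ?_ ?_ ?_) (tameNorm c) ?_, ?_⟩
  · intro f f' g
    rw [form, form, form, ← (hc.summable_form r s f g).tsum_add (hc.summable_form r s f' g)]
    simp only [overlap_add, add_mul, mul_add]
  · intro a f g
    rw [form, form, Complex.real_smul, ← tsum_mul_left]
    simp only [overlap_real_smul]
    exact tsum_congr fun p => by ring
  · intro f g g'
    rw [form, form, form, ← (hc.summable_form r s f g).tsum_add (hc.summable_form r s f g')]
    simp only [overlap_add, map_add, mul_add]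
  · intro a f g
    rw [form, form, Complex.real_smul, ← tsum_mul_left]
    simp only [overlap_real_smul, map_mul, Complex.conj_ofReal]
    exact tsum_congr fun p => by ring
  · exact fun f g => hc.norm_form_le r s f g
  · intro f g; rfl

end Form

/-! ### Bilinears in the CAR algebra and their expectations. -/

section Algebra

variable {A : Type*} [CStarAlgebra A]

/-- The anticommutation relations give a² = 0 and (a*a)² = ‖f‖² a*a; the C*-identity turns this into
a norm bound. -/
lemma CARAlgebra.norm_annih_le (C : CARAlgebra d A) (r : Reservoir) (f : OneParticle d) :
    ‖C.annih r f‖ ≤ ‖f‖ := by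
  set a := C.annih r f with ha
  have h0 : a * a = 0 := by
    have := C.anticomm r r f f
    have h2 : (2 : ℂ) • (a * a) = 0 := by rw [two_smul]; exact this
    exact (smul_eq_zero.1 h2).resolve_left two_ne_zero
  have h1 : a * star a = (inner ℂ f f : ℂ) • (1 : A) - star a * a := by
    have := C.anticomm_star r r f f
    rw [if_pos rfl] at this
    exact eq_sub_of_add_eq this
  have h3 : star (star a * a) * (star a * a) = (inner ℂ f f : ℂ) • (star a * a) := by
    rw [star_mul, star_star]
    calc star a * a * (star a * a) = star a * (a * star a) * a := by simp only [mul_assoc]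
      _ = _ := by
        rw [h1, mul_sub, sub_mul, mul_smul_comm, mul_one, smul_mul_assoc]
        rw [show star a * (star a * a) * a = star a * star a * (a * a) by simp only [mul_assoc],
          h0, mul_zero, sub_zero]
  have h4 : ‖star a * a‖ * ‖star a * a‖ = ‖f‖ ^ 2 * ‖star a * a‖ := by
    rw [← CStarRing.norm_star_mul_self, h3, norm_smul, inner_self_eq_norm_sq_to_K]
    simp
  have h5 : ‖star a * a‖ ≤ ‖f‖ ^ 2 := by
    rcases (norm_nonneg (star a * a)).eq_or_lt with h | h
    · rw [← h]; positivity
    · exact (mul_right_cancel₀ h.ne' h4).le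
  rw [CStarRing.norm_star_mul_self] at h5
  exact abs_le_of_sq_le_sq' (by nlinarith) (norm_nonneg f) |>.2

lemma CARAlgebra.continuous_annih (C : CARAlgebra d A) (r : Reservoir) :
    Continuous (C.annih r) := by
  rw [continuous_iff_continuousAt]
  intro f
  rw [ContinuousAt, tendsto_iff_norm_sub_tendsto_zero]
  refine squeeze_zero (fun _ => norm_nonneg _) (fun g => ?_)
    (tendsto_iff_norm_sub_tendsto_zero.1 (tendsto_id (α := OneParticle d) (x := 𝓝 f)))
  rw [← map_sub]
  exact C.norm_annih_le r _

/-- The bilinear expression `a*(f, r) a(g, s)`. -/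
noncomputable def CARAlgebra.hop (C : CARAlgebra d A) (r s : Reservoir) (f g : OneParticle d) : A :=
  star (C.annih r f) * C.annih s g

lemma CARAlgebra.norm_hop_le (C : CARAlgebra d A) (r s : Reservoir) (f g : OneParticle d) :
    ‖C.hop r s f g‖ ≤ ‖f‖ * ‖g‖ := by
  refine (norm_mul_le _ _).trans ?_
  rw [norm_star]
  exact mul_le_mul (C.norm_annih_le r f) (C.norm_annih_le s g) (norm_nonneg _) (norm_nonneg _)

/-- The quartic terms cancel because moving a pair of field operators past a pair produces no sign;
only the contractions survive. -/
lemma CARAlgebra.commutator_hop (C : CARAlgebra d A) (r s t u : Reservoir)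
    (f g h k : OneParticle d) :
    C.hop r s f g * C.hop t u h k - C.hop t u h k * C.hop r s f g =
      (if s = t then (inner ℂ g h : ℂ) else 0) • C.hop r u f k -
        (if u = r then (inner ℂ k f : ℂ) else 0) • C.hop t s h g := by
  have e1 : C.annih s g * star (C.annih t h) =
      (if s = t then (inner ℂ g h : ℂ) else 0) • (1 : A) - star (C.annih t h) * C.annih s g := by
    rw [eq_sub_iff_add_eq, C.anticomm_star]
    split_ifs <;> simp
  have e2 : C.annih u k * star (C.annih r f) =
      (if u = r then (inner ℂ k f : ℂ) else 0) • (1 : A) - star (C.annih r f) * C.annih u k := by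
    rw [eq_sub_iff_add_eq, C.anticomm_star]
    split_ifs <;> simp
  have e3 : C.annih s g * C.annih u k = -(C.annih u k * C.annih s g) :=
    eq_neg_of_add_eq_zero_left (C.anticomm s u g k)
  have e4 : star (C.annih r f) * star (C.annih t h) =
      -(star (C.annih t h) * star (C.annih r f)) := by
    have := congrArg star (C.anticomm t r h f)
    rw [star_add, star_mul, star_mul, star_zero] at this
    exact eq_neg_of_add_eq_zero_left this
  simp only [hop]
  calc _ = star (C.annih r f) * (C.annih s g * star (C.annih t h)) * C.annih u k -
        star (C.annih t h) * (C.annih u k * star (C.annih r f)) * C.annih s g := by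
        simp only [mul_assoc]
    _ = _ := by
      rw [e1, e2]
      simp only [mul_sub, sub_mul, mul_smul_comm, smul_mul_assoc, mul_one]
      rw [show star (C.annih r f) * (star (C.annih t h) * C.annih s g) * C.annih u k =
        (star (C.annih r f) * star (C.annih t h)) * (C.annih s g * C.annih u k) by
          simp only [mul_assoc], e3, e4]
      noncomm_ring

/-- The map `X ↦ {[a(f, r), X], a*(g, s)}`. -/
noncomputable def CARAlgebra.probe (C : CARAlgebra d A) (r s : Reservoir) (f g : OneParticle d) :
    A →L[ℂ] A :=
  (ContinuousLinearMap.mul ℂ A).flip (star (C.annih s g)) ∘L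
      (ContinuousLinearMap.mul ℂ A (C.annih r f) - (ContinuousLinearMap.mul ℂ A).flip (C.annih r f))
    + ContinuousLinearMap.mul ℂ A (star (C.annih s g)) ∘L
      (ContinuousLinearMap.mul ℂ A (C.annih r f) - (ContinuousLinearMap.mul ℂ A).flip (C.annih r f))

/-- Commutator and anticommutator each strip off one field operator, leaving a scalar. The probe
thus reads the components of a kernel off its second quantization. -/
lemma CARAlgebra.probe_hop (C : CARAlgebra d A) (r s t u : Reservoir) (f g h k : OneParticle d) :
    C.probe r s f g (C.hop t u h k) =
      ((if t = r then (inner ℂ f h : ℂ) else 0) * (if u = s then (inner ℂ k g : ℂ) else 0)) •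
        (1 : A) := by
  have e1 : C.annih r f * star (C.annih t h) =
      (if t = r then (inner ℂ f h : ℂ) else 0) • (1 : A) - star (C.annih t h) * C.annih r f := by
    rw [eq_sub_iff_add_eq, C.anticomm_star]
    simp only [eq_comm (a := t)]
    split_ifs <;> simp
  have e2 : C.annih u k * star (C.annih s g) =
      (if u = s then (inner ℂ k g : ℂ) else 0) • (1 : A) - star (C.annih s g) * C.annih u k := by
    rw [eq_sub_iff_add_eq, C.anticomm_star]
    split_ifs <;> simp
  have e3 : C.annih r f * C.annih u k = -(C.annih u k * C.annih r f) :=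
    eq_neg_of_add_eq_zero_left (C.anticomm r u f k)
  have e5 : C.annih r f * C.hop t u h k - C.hop t u h k * C.annih r f =
      (if t = r then (inner ℂ f h : ℂ) else 0) • C.annih u k := by
    rw [hop, ← mul_assoc, e1, sub_mul, smul_mul_assoc, one_mul, mul_assoc, e3, mul_assoc]
    noncomm_ring
  have e6 : C.probe r s f g (C.hop t u h k) =
      (C.annih r f * C.hop t u h k - C.hop t u h k * C.annih r f) * star (C.annih s g) +
      star (C.annih s g) * (C.annih r f * C.hop t u h k - C.hop t u h k * C.annih r f) := rfl
  rw [e6, e5, smul_mul_assoc, mul_smul_comm, ← smul_add, e2, sub_add_cancel, smul_smul]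

/-- The second quantization of the operator with Hermite coefficients `c`. -/
noncomputable def CARAlgebra.second (C : CARAlgebra d A) (c : Mode d × Mode d → ℂ) : A :=
  ∑' p, c p • C.hop p.1.1 p.2.1 (mode p.1.2) (mode p.2.2)

lemma CARAlgebra.quantize_eq_second (C : CARAlgebra d A) (w : Kernel d 1) :
    C.quantize w = C.second (kernelCoeff w) := by
  rw [quantize, second, ← ((Equiv.funUnique (Fin 1) (Mode d)).symm.prodCongr
      (Equiv.funUnique (Fin 1) (Mode d)).symm).tsum_eq]
  refine tsum_congr fun p => ?_
  simp [hop, kernelCoeff, mode, Equiv.prodCongr_apply, uniqueElim_const]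

lemma CARAlgebra.norm_smul_hop_le (C : CARAlgebra d A) (c : Mode d × Mode d → ℂ)
    (p : Mode d × Mode d) {f g : OneParticle d} (hf : ‖f‖ ≤ 1) (hg : ‖g‖ ≤ 1) :
    ‖c p • C.hop p.1.1 p.2.1 f g‖ ≤ ‖c p‖ := by
  rw [norm_smul]
  exact mul_le_of_le_one_right (norm_nonneg _)
    ((C.norm_hop_le _ _ _ _).trans (mul_le_one₀ hf (norm_nonneg _) hg))

lemma CARAlgebra.summable_second (C : CARAlgebra d A) {c : Mode d × Mode d → ℂ} (hc : Tame c) :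
    Summable fun p => c p • C.hop p.1.1 p.2.1 (mode p.1.2) (mode p.2.2) :=
  Summable.of_norm_bounded hc.summable_norm
    fun p => C.norm_smul_hop_le c p (norm_mode _).le (norm_mode _).le

lemma CARAlgebra.map_second (C : CARAlgebra d A) {c : Mode d × Mode d → ℂ} (hc : Tame c)
    {B : Type*} [NormedAddCommGroup B] [NormedSpace ℂ B] (φ : A →L[ℂ] B) :
    φ (C.second c) = ∑' p, c p • φ (C.hop p.1.1 p.2.1 (mode p.1.2) (mode p.2.2)) := by
  rw [second, φ.map_tsum (C.summable_second hc)]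
  simp only [map_smul]

/-- A star homomorphism as a continuous linear map. -/
noncomputable def homCLM (φ : A →⋆ₐ[ℂ] A) : A →L[ℂ] A :=
  LinearMap.mkContinuous φ.toAlgHom.toLinearMap 1
    fun x => by simpa using NonUnitalStarAlgHom.norm_apply_le φ x

@[simp] lemma homCLM_apply (φ : A →⋆ₐ[ℂ] A) (x : A) : homCLM φ x = φ x := rfl

lemma conj_overlap (s : Reservoir) (g : OneParticle d) (i : Mode d) :
    starRingEnd ℂ (overlap s g i) = if i.1 = s then (inner ℂ (mode i.2) g : ℂ) else 0 := by
  unfold overlap; split_ifs <;> simp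

/-- Only two-point functions occur, which are the case n = 1 of `wick`; symmetry of T lets it act on
the external vectors. -/
lemma CARAlgebra.commutator_hop_second (C : CARAlgebra d A) {o : Mode d × Mode d → ℂ} (ho : Tame o)
    {T : Reservoir → OneParticle d → OneParticle d} {ω : A →L[ℂ] ℂ}
    (hω : C.IsQuasiFreeState T ω)
    (hT : ∀ r f g, (inner ℂ f (T r g) : ℂ) = inner ℂ (T r f) g)
    (r s : Reservoir) (f g : OneParticle d) :
    ω (C.hop r s f g * C.second o - C.second o * C.hop r s f g) =
      form o s r g (T r f) - form o s r (T s g) f := by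
  have two : ∀ r s f g, ω (C.hop r s f g) = if r = s then (inner ℂ g (T r f) : ℂ) else 0 := by
    intro r s f g
    have := hω.wick 1 (fun _ => (r, f)) (fun _ => (s, g))
    simpa [hop] using this
  have e := C.map_second ho (ω ∘L (ContinuousLinearMap.mul ℂ A (C.hop r s f g) -
    (ContinuousLinearMap.mul ℂ A).flip (C.hop r s f g)))
  simp only [ContinuousLinearMap.comp_apply, sub_apply,
    ContinuousLinearMap.mul_apply', ContinuousLinearMap.flip_apply] at e
  rw [e, form, form, ← (ho.summable_form _ _ _ _).tsum_sub (ho.summable_form _ _ _ _)]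
  refine tsum_congr fun p => ?_
  rw [C.commutator_hop, map_sub, map_smul, map_smul, two, two, conj_overlap, conj_overlap, overlap,
    overlap]
  simp only [smul_eq_mul, eq_comm (a := s), eq_comm (a := r)]
  rw [← mul_sub]
  congr 1
  congr 1
  by_cases h1 : p.1.1 = s
  · subst h1
    simp only [if_true, hT]
    ring
  · simp [h1]

lemma CARAlgebra.probe_second (C : CARAlgebra d A) {c : Mode d × Mode d → ℂ} (hc : Tame c)
    (r s : Reservoir) (f g : OneParticle d) :
    C.probe r s f g (C.second c) = form c r s f g • (1 : A) := by
  rw [C.map_second hc, form, ← (hc.summable_form r s f g).tsum_smul_const]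
  refine tsum_congr fun p => ?_
  rw [C.probe_hop, smul_smul, conj_overlap, overlap]

end Algebra

/-! ### Time correlation functions: continuity, decay and cyclicity. -/

lemma EnergyBound.continuous_energyFunction {m : ℝ → ℂ} {C : ℝ} (h : EnergyBound m C) :
    Continuous (energyFunction m : OneParticle d → OneParticle d) := by
  rw [continuous_iff_continuousAt]
  intro f
  rw [ContinuousAt, tendsto_iff_norm_sub_tendsto_zero]
  have h0 := (tendsto_iff_norm_sub_tendsto_zero.1
    (tendsto_id (α := OneParticle d) (x := 𝓝 f))).const_mul C
  rw [mul_zero] at h0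
  refine squeeze_zero (fun _ => norm_nonneg _) (fun g => ?_) h0
  rw [← energyFunction_sub h]
  exact norm_energyFunction_le h _

lemma energyBound_one : EnergyBound (fun _ => (1 : ℂ)) 1 := ⟨measurable_const, fun _ _ => by simp⟩

/-- A Hermite function evolved backwards in time, to which a function of the energy is applied. -/
noncomputable def evolved (m : ℝ → ℂ) (t : ℝ) (q : Fin d → ℕ) : OneParticle d :=
  energyFunction m (freeProp (-t) (mode q))

lemma norm_evolved_le {m : ℝ → ℂ} {C : ℝ} (h : EnergyBound m C) (t : ℝ) (q : Fin d → ℕ) :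
    ‖evolved m t q‖ ≤ C := by
  refine (norm_energyFunction_le h _).trans ?_
  rw [norm_freeProp, norm_mode, mul_one]

lemma evolved_one (t : ℝ) (q : Fin d → ℕ) :
    evolved (fun _ => 1) t q = freeProp (-t) (mode q) := energyFunction_one _

lemma continuous_evolved {m : ℝ → ℂ} {C : ℝ} (h : EnergyBound m C) (q : Fin d → ℕ) :
    Continuous fun t => evolved m t q :=
  h.continuous_energyFunction.comp ((continuous_freeProp _).comp continuous_neg)

/-- The summands of `corr`. -/
noncomputable def corrTerm (a o : Mode d × Mode d → ℂ) (r s : Reservoir) (m n : ℝ → ℂ) (t : ℝ)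
    (p : Mode d × Mode d) : ℂ :=
  if p.1.1 = r ∧ p.2.1 = s then a p * form o s r (evolved n t p.2.2) (evolved m t p.1.2) else 0

/-- The trace of `m(h) e^{-ith} a_{rs} e^{ith} n(h)^* o_{sr}`, with `h` the one-particle energy. -/
noncomputable def corr (a o : Mode d × Mode d → ℂ) (r s : Reservoir) (m n : ℝ → ℂ) (t : ℝ) : ℂ :=
  ∑' p, corrTerm a o r s m n t p

section Corr

variable {a o : Mode d × Mode d → ℂ} {r s : Reservoir} {m n : ℝ → ℂ} {C C' : ℝ}

lemma norm_corrTerm_le (ho : Tame o) (hm : EnergyBound m C) (hn : EnergyBound n C') (t : ℝ)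
    (p : Mode d × Mode d) : ‖corrTerm a o r s m n t p‖ ≤ ‖a p‖ * (tameNorm o * C' * C) := by
  have hC := hm.nonneg
  have hC' := hn.nonneg
  have := tameNorm_nonneg o
  unfold corrTerm
  split_ifs
  · rw [norm_mul]
    refine mul_le_mul_of_nonneg_left ((ho.norm_form_le _ _ _ _).trans ?_) (norm_nonneg _)
    have h1 := norm_evolved_le hn t p.2.2
    have h2 := norm_evolved_le hm t p.1.2
    gcongr
  · rw [norm_zero]; positivity

lemma summable_corrTerm (ha : Tame a) (ho : Tame o) (hm : EnergyBound m C) (hn : EnergyBound n C')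
    (t : ℝ) : Summable (corrTerm a o r s m n t) :=
  Summable.of_norm_bounded (ha.summable_norm.mul_right _) (norm_corrTerm_le ho hm hn t)

lemma continuous_corr (ha : Tame a) (ho : Tame o) (hm : EnergyBound m C) (hn : EnergyBound n C') :
    Continuous (corr a o r s m n) := by
  refine continuous_tsum (fun p => ?_) (ha.summable_norm.mul_right _)
    fun p t => norm_corrTerm_le ho hm hn t p
  unfold corrTerm
  split_ifs
  · obtain ⟨b, hb⟩ := ho.exists_bilin s r
    simp only [← hb]
    exact continuous_const.mul
      ((b.continuous.comp (continuous_evolved hn _)).clm_apply (continuous_evolved hm _))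
  · exact continuous_const

lemma norm_overlap_evolved_le (hd : 3 ≤ d) (s : Reservoir) (t : ℝ) (q : Fin d → ℕ) (i : Mode d) :
    ‖overlap s (evolved (fun _ => 1) t q) i‖ ≤ decay t * (hermiteBound q * hermiteBound i.2) := by
  unfold overlap
  split_ifs
  · rw [evolved_one, inner_freeProp_left, neg_neg]
    exact norm_inner_mode_freeProp_le hd _ _ _
  · rw [norm_zero]
    exact mul_nonneg (decay_nonneg t) (mul_nonneg (hermiteBound_pos _).le (hermiteBound_pos _).le)

/-- Only the leg without m has to decay; the other enters through its L² norm. Hence m contributes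
nothing but its supremum C, and no smoothness of m is needed. -/
lemma norm_form_evolved_le (hd : 3 ≤ d) (ho : Tame o) (hm : EnergyBound m C) (s r : Reservoir)
    (t : ℝ) (q q' : Fin d → ℕ) :
    ‖form o s r (evolved (fun _ => 1) t q) (evolved m t q')‖ ≤
      tameNorm o * (decay t * hermiteBound q * C) := by
  have hC := hm.nonneg
  rw [tameNorm, ← tsum_mul_right]
  refine tsum_of_norm_bounded (ho.mul_right _).hasSum fun p => ?_
  rw [norm_mul, norm_mul, RCLike.norm_conj, mul_assoc]
  refine mul_le_mul_of_nonneg_left ?_ (norm_nonneg _)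
  have h1 := norm_overlap_evolved_le hd s t q p.1
  have h2 := (norm_overlap_le r (evolved m t q') p.2).trans (norm_evolved_le hm t q')
  have hB := one_le_hermiteBound p.2.2
  have hq := (hermiteBound_pos q).le
  have hp := (hermiteBound_pos p.1.2).le
  have hD := decay_nonneg t
  calc _ ≤ decay t * (hermiteBound q * hermiteBound p.1.2) * C :=
        mul_le_mul h1 h2 (norm_nonneg _) (by positivity)
    _ = hermiteBound p.1.2 * 1 * (decay t * hermiteBound q * C) := by ring
    _ ≤ _ := by unfold pairWeight; gcongr

lemma norm_corr_le (hd : 3 ≤ d) (ha : Tame a) (ho : Tame o) (hm : EnergyBound m C) (t : ℝ) :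
    ‖corr a o r s m (fun _ => 1) t‖ ≤ tameNorm a * (tameNorm o * C) * decay t := by
  have hC := hm.nonneg
  have h0 := tameNorm_nonneg o
  have hD := decay_nonneg t
  rw [mul_assoc, tameNorm, ← tsum_mul_right]
  refine tsum_of_norm_bounded (ha.mul_right _).hasSum fun p => ?_
  unfold corrTerm
  split_ifs
  · rw [norm_mul, mul_assoc]
    refine mul_le_mul_of_nonneg_left ((norm_form_evolved_le hd ho hm _ _ _ _ _).trans ?_)
      (norm_nonneg _)
    have hB := one_le_hermiteBound p.1.2
    have hq := (hermiteBound_pos p.2.2).le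
    calc _ = 1 * hermiteBound p.2.2 * (tameNorm o * C * decay t) := by ring
      _ ≤ _ := by unfold pairWeight; gcongr
  · rw [norm_zero]
    exact mul_nonneg (mul_nonneg (norm_nonneg _) (pairWeight_nonneg p)) (by positivity)

lemma corrTerm_eq_tsum (p : Mode d × Mode d) (t : ℝ) :
    corrTerm a o r s m n t p = ∑' p', (if (p.1.1 = r ∧ p.2.1 = s) ∧ (p'.1.1 = s ∧ p'.2.1 = r) then
      a p * o p' * ((inner ℂ (evolved n t p.2.2) (mode p'.1.2) : ℂ) *
        inner ℂ (mode p'.2.2) (evolved m t p.1.2)) else 0) := by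
  unfold corrTerm
  split_ifs with h
  · rw [form, ← tsum_mul_left]
    refine tsum_congr fun p' => ?_
    rw [conj_overlap, overlap]
    by_cases h1 : p'.1.1 = s <;> by_cases h2 : p'.2.1 = r <;> simp [h, h1, h2]
    ring
  · simp [h]

/-- Cyclicity of the trace. -/
lemma corr_swap (ha : Tame a) (ho : Tame o) (hm : EnergyBound m C) (hn : EnergyBound n C') (t : ℝ) :
    corr a o r s m n t =
      corr o a s r (fun e => starRingEnd ℂ (n e)) (fun e => starRingEnd ℂ (m e)) (-t) := by
  unfold corr
  simp only [corrTerm_eq_tsum]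
  have hC := hm.nonneg
  have hC' := hn.nonneg
  -- The trace is a double sum over the coefficients of a and of o; absolute convergence permits
  -- exchanging the two sums, which is the cyclicity.
  have hsum : Summable (Function.uncurry fun p p' : Mode d × Mode d =>
      (if (p.1.1 = r ∧ p.2.1 = s) ∧ (p'.1.1 = s ∧ p'.2.1 = r) then
      a p * o p' * ((inner ℂ (evolved n t p.2.2) (mode p'.1.2) : ℂ) *
        inner ℂ (mode p'.2.2) (evolved m t p.1.2)) else 0)) := by
    refine Summable.of_norm_bounded ((ha.summable_norm.mul_of_nonneg ho.summable_norm
      (fun _ => norm_nonneg _) (fun _ => norm_nonneg _)).mul_right (C' * C)) fun z => ?_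
    simp only [Function.uncurry]
    split_ifs
    · rw [norm_mul, norm_mul, norm_mul]
      refine mul_le_mul_of_nonneg_left (mul_le_mul ?_ ?_ (norm_nonneg _) hC') (by positivity)
      · refine (norm_inner_le_norm _ _).trans ?_
        rw [norm_mode, mul_one]
        exact norm_evolved_le hn _ _
      · refine (norm_inner_le_norm _ _).trans ?_
        rw [norm_mode, one_mul]
        exact norm_evolved_le hm _ _
    · rw [norm_zero]; positivity
  rw [← hsum.tsum_comm]
  refine tsum_congr fun p' => tsum_congr fun p => ?_
  simp only [and_comm (a := p.1.1 = r ∧ p.2.1 = s)]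
  by_cases h : (p'.1.1 = s ∧ p'.2.1 = r) ∧ (p.1.1 = r ∧ p.2.1 = s)
  · rw [if_pos h, if_pos h]
    have e1 : ∀ {k : ℝ → ℂ} {K : ℝ} (_ : EnergyBound k K) (f g : OneParticle d) (t : ℝ),
        (inner ℂ (energyFunction (fun e => starRingEnd ℂ (k e)) (freeProp t f)) g : ℂ) =
        inner ℂ f (energyFunction k (freeProp (-t) g)) := by
      intro k K hk f g t
      rw [inner_energyFunction_left hk.conj, inner_freeProp_left, freeProp_energyFunction
        (by simpa using hk)]
      simp
    have e2 : ∀ {k : ℝ → ℂ} {K : ℝ} (_ : EnergyBound k K) (f g : OneParticle d) (t : ℝ),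
        (inner ℂ (energyFunction k (freeProp (-t) f)) g : ℂ) =
        inner ℂ f (energyFunction (fun e => starRingEnd ℂ (k e)) (freeProp t g)) := by
      intro k K hk f g t
      rw [inner_energyFunction_left hk, inner_freeProp_left, freeProp_energyFunction hk.conj,
        neg_neg]
    simp only [evolved, neg_neg]
    rw [e1 hm, e2 hn]
    ring
  · rw [if_neg h, if_neg h]

lemma evolved_add {m' : ℝ → ℂ} (hm : EnergyBound m C) (hm' : EnergyBound m' C') (t : ℝ)
    (q : Fin d → ℕ) : evolved (fun e => m e + m' e) t q = evolved m t q + evolved m' t q :=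
  energyFunction_add_fun hm hm' _

lemma corr_add_fun {m' : ℝ → ℂ} {C₁ : ℝ} (ha : Tame a) (ho : Tame o) (hm : EnergyBound m C)
    (hm' : EnergyBound m' C₁) (hn : EnergyBound n C') (t : ℝ) :
    corr a o r s (fun e => m e + m' e) n t = corr a o r s m n t + corr a o r s m' n t := by
  rw [corr, corr, corr, ← (summable_corrTerm ha ho hm hn t).tsum_add
    (summable_corrTerm ha ho hm' hn t)]
  refine tsum_congr fun p => ?_
  obtain ⟨b, hb⟩ := ho.exists_bilin s r
  unfold corrTerm
  split_ifs
  · rw [evolved_add hm hm', ← hb, ← hb, ← hb, map_add, mul_add]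
  · simp

lemma form_smul_right (c : Mode d × Mode d → ℂ) (r s : Reservoir) (z : ℂ) (f g : OneParticle d) :
    form c r s f (z • g) = z * form c r s f g := by
  rw [form, form, ← tsum_mul_left]
  refine tsum_congr fun p => ?_
  rw [conj_overlap, conj_overlap]
  split_ifs <;> simp [inner_smul_right]
  ring

lemma corr_const_mul (hm : EnergyBound m C) (z : ℂ) (t : ℝ) :
    corr a o r s (fun e => z * m e) n t = z * corr a o r s m n t := by
  rw [corr, corr, ← tsum_mul_left]
  refine tsum_congr fun p => ?_
  have : ∀ q : Fin d → ℕ, evolved (fun e => z * m e) t q = z • evolved m t q :=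
    fun q => energyFunction_const_mul hm z _
  unfold corrTerm
  split_ifs
  · rw [this, form_smul_right]; ring
  · simp

lemma form_const_mul (c : Mode d × Mode d → ℂ) {c' : Mode d × Mode d → ℂ} (r s : Reservoir) {z : ℂ}
    (h : ∀ p, p.1.1 = r → p.2.1 = s → c' p = z * c p) (f g : OneParticle d) :
    form c' r s f g = z * form c r s f g := by
  rw [form, form, ← tsum_mul_left]
  refine tsum_congr fun p => ?_
  unfold overlap
  by_cases h1 : p.1.1 = r <;> by_cases h2 : p.2.1 = s <;> simp [h1, h2]
  rw [h p h1 h2]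
  ring

lemma corr_congr_right {o' : Mode d × Mode d → ℂ} {z : ℂ}
    (h : ∀ f g, form o' s r f g = z * form o s r f g) (t : ℝ) :
    corr a o' r s m n t = z * corr a o r s m n t := by
  rw [corr, corr, ← tsum_mul_left]
  refine tsum_congr fun p => ?_
  unfold corrTerm
  rw [h]
  split_ifs
  · ring
  · simp

end Corr

/-! ### Time derivatives of the correlation functions. -/

section Derivative

lemma norm_phase_sub_le (x : ℝ) : ‖Complex.exp (Complex.I * x) - 1 - Complex.I * x‖ ≤ 3 * x ^ 2 := by
  rcases le_or_gt |x| 1 with h | h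
  · have h1 : ‖Complex.I * (x : ℂ)‖ = |x| := by simp
    have := Complex.norm_exp_sub_one_sub_id_le (x := Complex.I * x) (by rw [h1]; exact h)
    rw [h1, sq_abs] at this
    nlinarith [sq_nonneg x]
  · have h1 : ‖Complex.exp (Complex.I * x)‖ = 1 := by
      rw [mul_comm]; exact Complex.norm_exp_ofReal_mul_I x
    have h2 := norm_sub_le (Complex.exp (Complex.I * x) - 1) (Complex.I * x)
    have h3 := norm_sub_le (Complex.exp (Complex.I * x)) 1
    have h4 : ‖Complex.I * (x : ℂ)‖ = |x| := by simp
    rw [h4] at h2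
    rw [h1, norm_one] at h3
    nlinarith [sq_abs x]

/-- The factor m tames the unbounded generator: since e²m(e) is bounded, the second-order remainder
of e^{-ite} m(e) is quadratic in time uniformly in e. -/
lemma hasDerivAt_evolved {m : ℝ → ℂ} {C C₁ C₂ : ℝ} (h0 : EnergyBound m C)
    (h1 : EnergyBound (fun e => -Complex.I * e * m e) C₁)
    (h2 : ∀ e, 0 ≤ e → e ^ 2 * ‖m e‖ ≤ C₂) (q : Fin d → ℕ) (t : ℝ) :
    HasDerivAt (fun t => evolved m t q) (evolved (fun e => -Complex.I * e * m e) t q) t := by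
  have e1 : ∀ t, evolved m t q = energyFunction (fun e => m e * phase (-t) e) (mode q) :=
    fun t => energyFunction_energyFunction h0 (phase_bound _) _
  have e2 : evolved (fun e => -Complex.I * e * m e) t q =
      energyFunction (fun e => (-Complex.I * e * m e) * phase (-t) e) (mode q) :=
    energyFunction_energyFunction h1 (phase_bound _) _
  simp only [e1, e2]
  refine hasDerivAt_energyFunction (C := 3 * C₂) (fun s => h0.mul (phase_bound (-s)))
    (h1.mul (phase_bound (-t))) (fun s e he => ?_) _
  have e3 : m e * phase (-s) e - m e * phase (-t) e -
      (s - t : ℝ) * (-Complex.I * e * m e * phase (-t) e) =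
      m e * phase (-t) e * (Complex.exp (Complex.I * (-(s - t) * e : ℝ)) - 1 -
        Complex.I * (-(s - t) * e : ℝ)) := by
    have : phase (-s) e = phase (-t) e * Complex.exp (Complex.I * (-(s - t) * e : ℝ)) := by
      rw [phase, phase, ← Complex.exp_add]
      push_cast
      ring_nf
    rw [this]
    push_cast
    ring
  rw [e3, norm_mul, norm_mul, norm_phase, mul_one]
  calc _ ≤ ‖m e‖ * (3 * (-(s - t) * e) ^ 2) :=
        mul_le_mul_of_nonneg_left (norm_phase_sub_le _) (norm_nonneg _)
    _ = 3 * (e ^ 2 * ‖m e‖) * (s - t) ^ 2 := by ring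
    _ ≤ _ := by have := h2 e he; gcongr

/-- Differentiation of a bounded bilinear expression `b(x(t), y(t))` where `y` is differentiable
while `x` is differentiable only when inserted into `b`. -/
lemma hasDerivAt_bilin_of_weak {E F : Type*} [NormedAddCommGroup E] [NormedSpace ℝ E]
    [NormedAddCommGroup F] [NormedSpace ℝ F] (b : E →L[ℝ] F →L[ℝ] ℂ) (b' : F → ℂ) {x : ℝ → E}
    {y : ℝ → F} {y' : F} {t : ℝ} (hx : Continuous x)
    (hxb : ∀ g, HasDerivAt (fun u => b (x u) g) (b' g) t) (hy : HasDerivAt y y' t) :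
    HasDerivAt (fun u => b (x u) (y u)) (b' (y t) + b (x t) y') t := by
  -- The expression splits as b(x_u, y_u - y_t - (u-t)y') + b(x_u, y_t) + (u-t) b(x_u, y'). In the
  -- first term x_u need only be locally bounded, because its partner is o(u-t).
  have h1 : HasDerivAt (fun u => b (x u) (y u - y t - (u - t) • y')) 0 t := by
    rw [hasDerivAt_iff_isLittleO]
    simp only [sub_self, zero_smul, map_zero, sub_zero, smul_zero]
    have hb : (fun u => b (x u)) =O[𝓝 t] fun _ => (1 : ℝ) :=
      (b.continuous.comp hx).continuousAt.isBigO_one ℝ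
    have h := hb.norm_left.mul_isLittleO (hasDerivAt_iff_isLittleO.1 hy).norm_left
    simp only [one_mul] at h
    exact (Asymptotics.IsBigO.of_bound 1 (Eventually.of_forall fun u => by
      rw [one_mul, Real.norm_of_nonneg (by positivity)]
      exact (b (x u)).le_opNorm _)).trans_isLittleO h
  have h2 : HasDerivAt (fun u : ℝ => (u - t) • b (x u) y') (b (x t) y') t := by
    have := (((hasDerivAt_id t).sub_const t).fun_smul (hxb y'))
    simpa using this
  have h3 := (h1.add (hxb (y t))).add h2
  refine (h3.congr_deriv (by ring)).congr_of_eventuallyEq (Eventually.of_forall fun u => ?_)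
  simp only [Pi.add_apply, map_sub, map_smul]
  ring

/-- The group law transports the derivative from time 0 to time t. -/
lemma hasDerivAt_freeProp_shift {φ : OneParticle d → ℂ} {φ' : OneParticle d → ℂ}
    (h : ∀ f, HasDerivAt (fun u : ℝ => φ (freeProp (-u) f)) (φ' f) 0) (f : OneParticle d) (t : ℝ) :
    HasDerivAt (fun u : ℝ => φ (freeProp (-u) f)) (φ' (freeProp (-t) f)) t := by
  have h1 := h (freeProp (-t) f)
  rw [← sub_self t] at h1
  have h2 := HasDerivAt.comp_sub_const t t h1
  refine h2.congr_of_eventuallyEq (Eventually.of_forall fun u => ?_)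
  simp only [freeProp_freeProp]
  congr 2
  ring

variable {a c v : Mode d × Mode d → ℂ} {r s : Reservoir} {m : ℝ → ℂ} {C C₁ C₂ : ℝ}

/-- Product rule. The leg without m has no factor damping high energies, so it is differentiated
only inside the form, through `hcv`, which yields v. The leg with m yields the energy factor. -/
lemma hasDerivAt_corrTerm_left (hc : Tame c) (h0 : EnergyBound m C)
    (h1 : EnergyBound (fun e => -Complex.I * e * m e) C₁)
    (h2 : ∀ e, 0 ≤ e → e ^ 2 * ‖m e‖ ≤ C₂)
    (hcv : ∀ f g, HasDerivAt (fun u : ℝ => form c s r (freeProp (-u) f) g) (form v s r f g) 0)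
    (p : Mode d × Mode d) (t : ℝ) :
    HasDerivAt (fun u => corrTerm a c r s m (fun _ => 1) u p)
      (corrTerm a v r s m (fun _ => 1) t p +
        corrTerm a c r s (fun e => -Complex.I * e * m e) (fun _ => 1) t p) t := by
  obtain ⟨b, hb⟩ := hc.exists_bilin s r
  unfold corrTerm
  split_ifs
  · simp only [← hb, evolved_one, ← mul_add]
    refine HasDerivAt.const_mul _ ?_
    refine hasDerivAt_bilin_of_weak b (form v s r (freeProp (-t) (mode p.2.2)))
      ((continuous_freeProp _).comp continuous_neg) (fun g => ?_)
      (hasDerivAt_evolved h0 h1 h2 _ t)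
    simp only [hb]
    exact hasDerivAt_freeProp_shift (φ := fun f => form c s r f g) (φ' := fun f => form v s r f g)
      (fun f => hcv f g) _ _
  · simpa using hasDerivAt_const t (0 : ℂ)

lemma hasDerivAt_corrTerm_right (hc : Tame c) (h0 : EnergyBound m C)
    (h1 : EnergyBound (fun e => -Complex.I * e * m e) C₁)
    (h2 : ∀ e, 0 ≤ e → e ^ 2 * ‖m e‖ ≤ C₂)
    (hcv : ∀ f g, HasDerivAt (fun u : ℝ => form c s r f (freeProp (-u) g)) (form v s r f g) 0)
    (p : Mode d × Mode d) (t : ℝ) :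
    HasDerivAt (fun u => corrTerm a c r s (fun _ => 1) m u p)
      (corrTerm a v r s (fun _ => 1) m t p +
        corrTerm a c r s (fun _ => 1) (fun e => -Complex.I * e * m e) t p) t := by
  obtain ⟨b, hb⟩ := hc.exists_bilin s r
  unfold corrTerm
  split_ifs
  · simp only [← hb, evolved_one, ← mul_add]
    refine HasDerivAt.const_mul _ ?_
    refine hasDerivAt_bilin_of_weak b.flip (fun f => form v s r f (freeProp (-t) (mode p.1.2)))
      ((continuous_freeProp _).comp continuous_neg) (fun f => ?_)
      (hasDerivAt_evolved h0 h1 h2 _ t)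
    simp only [ContinuousLinearMap.flip_apply, hb]
    exact hasDerivAt_freeProp_shift (φ := fun g => form c s r f g) (φ' := fun g => form v s r f g)
      (fun g => hcv f g) _ _
  · simpa using hasDerivAt_const t (0 : ℂ)

lemma hasDerivAt_corr_left (ha : Tame a) (hc : Tame c) (hv : Tame v) (h0 : EnergyBound m C)
    (h1 : EnergyBound (fun e => -Complex.I * e * m e) C₁)
    (h2 : ∀ e, 0 ≤ e → e ^ 2 * ‖m e‖ ≤ C₂)
    (hcv : ∀ f g, HasDerivAt (fun u : ℝ => form c s r (freeProp (-u) f) g) (form v s r f g) 0)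
    (t : ℝ) :
    HasDerivAt (corr a c r s m fun _ => 1) (corr a v r s m (fun _ => 1) t +
      corr a c r s (fun e => -Complex.I * e * m e) (fun _ => 1) t) t := by
  have hb1 := energyBound_one
  have e : corr a v r s m (fun _ => 1) t +
      corr a c r s (fun e => -Complex.I * e * m e) (fun _ => 1) t =
      ∑' p, (corrTerm a v r s m (fun _ => 1) t p +
        corrTerm a c r s (fun e => -Complex.I * e * m e) (fun _ => 1) t p) :=
    ((summable_corrTerm ha hv h0 hb1 t).tsum_add (summable_corrTerm ha hc h1 hb1 t)).symm
  rw [e]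
  exact hasDerivAt_tsum (g := fun p u => corrTerm a c r s m (fun _ => 1) u p)
    (g' := fun p u => corrTerm a v r s m (fun _ => 1) u p +
        corrTerm a c r s (fun e => -Complex.I * e * m e) (fun _ => 1) u p)
    ((ha.summable_norm.mul_right _).add (ha.summable_norm.mul_right _))
    (hasDerivAt_corrTerm_left hc h0 h1 h2 hcv)
    (fun p u => norm_add_le_of_le (norm_corrTerm_le hv h0 hb1 u p)
      (norm_corrTerm_le hc h1 hb1 u p)) (summable_corrTerm ha hc h0 hb1 0) t

lemma hasDerivAt_corr_right (ha : Tame a) (hc : Tame c) (hv : Tame v) (h0 : EnergyBound m C)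
    (h1 : EnergyBound (fun e => -Complex.I * e * m e) C₁)
    (h2 : ∀ e, 0 ≤ e → e ^ 2 * ‖m e‖ ≤ C₂)
    (hcv : ∀ f g, HasDerivAt (fun u : ℝ => form c s r f (freeProp (-u) g)) (form v s r f g) 0)
    (t : ℝ) :
    HasDerivAt (corr a c r s (fun _ => 1) m) (corr a v r s (fun _ => 1) m t +
      corr a c r s (fun _ => 1) (fun e => -Complex.I * e * m e) t) t := by
  have hb1 := energyBound_one
  have e : corr a v r s (fun _ => 1) m t +
      corr a c r s (fun _ => 1) (fun e => -Complex.I * e * m e) t =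
      ∑' p, (corrTerm a v r s (fun _ => 1) m t p +
        corrTerm a c r s (fun _ => 1) (fun e => -Complex.I * e * m e) t p) :=
    ((summable_corrTerm ha hv hb1 h0 t).tsum_add (summable_corrTerm ha hc hb1 h1 t)).symm
  rw [e]
  exact hasDerivAt_tsum (g := fun p u => corrTerm a c r s (fun _ => 1) m u p)
    (g' := fun p u => corrTerm a v r s (fun _ => 1) m u p +
        corrTerm a c r s (fun _ => 1) (fun e => -Complex.I * e * m e) u p)
    ((ha.summable_norm.mul_right _).add (ha.summable_norm.mul_right _))
    (hasDerivAt_corrTerm_right hc h0 h1 h2 hcv)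
    (fun p u => norm_add_le_of_le (norm_corrTerm_le hv hb1 h0 u p)
      (norm_corrTerm_le hc hb1 h1 u p)) (summable_corrTerm ha hc hb1 h0 0) t

end Derivative

/-! ### Free evolutions and gauge transformations of second-quantized operators. -/

variable {A : Type*} [CStarAlgebra A]

/-- The free time evolution of reservoir `r`, acting on vectors of reservoir `s`. -/
noncomputable def localProp (r : Reservoir) (u : ℝ) (s : Reservoir) (f : OneParticle d) :
    OneParticle d := if s = r then freeProp u f else f

lemma inner_localProp_left (r : Reservoir) (u : ℝ) (s : Reservoir) (f g : OneParticle d) :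
    (inner ℂ (localProp r u s f) g : ℂ) = inner ℂ f (localProp r (-u) s g) := by
  unfold localProp; split_ifs <;> simp [inner_freeProp_left]

/-- The particle number of reservoir `I` carried by a particle of reservoir `r`. -/
def charge : Reservoir → ℝ
  | Reservoir.I => 1
  | Reservoir.II => 0

namespace FreeReservoirs

variable (S : FreeReservoirs d A)

lemma evol_hop (r s t : Reservoir) (u : ℝ) (f g : OneParticle d) :
    S.evol r u (S.hop s t f g) = S.hop s t (localProp r u s f) (localProp r u t g) := by
  simp only [CARAlgebra.hop, map_mul, map_star, S.evol_annih, localProp]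

lemma freeEvol_annih (u : ℝ) (s : Reservoir) (f : OneParticle d) :
    S.freeEvol u (S.annih s f) = S.annih s (freeProp u f) := by
  cases s <;> simp [freeEvol, S.evol_annih]

lemma freeEvol_hop (s t : Reservoir) (u : ℝ) (f g : OneParticle d) :
    S.freeEvol u (S.hop s t f g) = S.hop s t (freeProp u f) (freeProp u g) := by
  simp only [CARAlgebra.hop, map_mul, map_star, S.freeEvol_annih]

lemma gauge_hop (s t : Reservoir) (u : ℝ) (f g : OneParticle d) :
    S.gauge Reservoir.I u (S.hop s t f g) =
      Complex.exp (Complex.I * (charge s - charge t : ℝ) * u) • S.hop s t f g := by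
  have h : ∀ (s : Reservoir) (f : OneParticle d), S.gauge Reservoir.I u (S.annih s f) =
      Complex.exp (-(Complex.I * charge s * u)) • S.annih s f := by
    intro s f
    cases s
    · rw [S.gauge_annih, if_pos rfl, map_smulₛₗ, ← Complex.exp_conj]
      simp [charge]
    · simp [S.gauge_annih, charge]
  have h2 : star (Complex.exp (-(Complex.I * charge s * u))) =
      Complex.exp (Complex.I * charge s * u) := by
    rw [Complex.star_def, ← Complex.exp_conj]
    simp
  rw [CARAlgebra.hop, map_mul, map_star, h, h, star_smul, smul_mul_smul_comm, h2, ← Complex.exp_add]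
  congr 2
  push_cast
  ring

/-- Each bilinear is only multiplied by a phase e^{κu} with κ ∈ {0, i, -i}, so the series may be
differentiated term by term. -/
lemma hasDerivAt_gauge_second {c : Mode d × Mode d → ℂ} (hc : Tame c) :
    HasDerivAt (fun u : ℝ => S.gauge Reservoir.I u (S.second c))
      (S.second fun p => Complex.I * (charge p.1.1 - charge p.2.1 : ℝ) * c p) 0 := by
  set X : Mode d × Mode d → A := fun p => c p • S.hop p.1.1 p.2.1 (mode p.1.2) (mode p.2.2) with hX
  set κ : Mode d × Mode d → ℂ := fun p => Complex.I * (charge p.1.1 - charge p.2.1 : ℝ) with hκ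
  have hXn : ∀ p, ‖X p‖ ≤ ‖c p‖ :=
    fun p => S.norm_smul_hop_le c p (norm_mode _).le (norm_mode _).le
  have hκn : ∀ p, ‖κ p‖ ≤ 1 := by
    rintro ⟨⟨r, q⟩, ⟨s, q'⟩⟩
    cases r <;> cases s <;> simp [hκ, charge]
  have hen : ∀ p (u : ℝ), ‖Complex.exp (κ p * u)‖ = 1 := by
    intro p u
    rw [hκ, mul_assoc, mul_comm, ← Complex.ofReal_mul, Complex.norm_exp_ofReal_mul_I]
  have e1 : ∀ u : ℝ, S.gauge Reservoir.I u (S.second c) = ∑' p, Complex.exp (κ p * u) • X p := by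
    intro u
    have := S.map_second hc (homCLM (S.gauge Reservoir.I u))
    simp only [homCLM_apply, gauge_hop] at this
    rw [this]
    exact tsum_congr fun p => smul_comm _ _ _
  have hd : ∀ p (u : ℝ), HasDerivAt (fun u : ℝ => Complex.exp (κ p * u) • X p)
      ((κ p * Complex.exp (κ p * u)) • X p) u := by
    intro p u
    have h1 : HasDerivAt (fun u : ℝ => κ p * (u : ℂ)) (κ p) u := by
      simpa using (Complex.ofRealCLM.hasDerivAt (x := u)).const_mul (κ p)
    have := h1.cexp.smul_const (X p)
    rwa [mul_comm] at this
  have h := hasDerivAt_tsum (𝕜 := ℝ) (F := A) hc.summable_norm hd (fun p u => by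
    rw [norm_smul, norm_mul, hen, mul_one]
    exact (mul_le_of_le_one_left (norm_nonneg _) (hκn p)).trans (hXn p)) (y₀ := 0)
    (Summable.of_norm_bounded hc.summable_norm fun p => by
      rw [norm_smul, hen, one_mul]; exact hXn p) 0
  simp only [e1]
  refine h.congr_deriv (tsum_congr fun p => ?_)
  simp [hX, hκ, smul_smul]

lemma freeEvol_second {c : Mode d × Mode d → ℂ} (hc : Tame c) (u : ℝ) :
    S.freeEvol u (S.second c) = ∑' p, c p • S.hop p.1.1 p.2.1 (freeProp u (mode p.1.2))
      (freeProp u (mode p.2.2)) := by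
  have := S.map_second hc (homCLM (S.freeEvol u))
  simpa only [homCLM_apply, freeEvol_hop] using this

lemma norm_smul_hop_freeProp_le (c : Mode d × Mode d → ℂ) (p : Mode d × Mode d) (u : ℝ) :
    ‖c p • S.hop p.1.1 p.2.1 (freeProp u (mode p.1.2)) (freeProp u (mode p.2.2))‖ ≤ ‖c p‖ :=
  S.norm_smul_hop_le c p (by rw [norm_freeProp, norm_mode]) (by rw [norm_freeProp, norm_mode])

lemma continuous_freeEvol_second {c : Mode d × Mode d → ℂ} (hc : Tame c) :
    Continuous fun u => S.freeEvol u (S.second c) := by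
  simp only [S.freeEvol_second hc]
  refine continuous_tsum (fun p => ?_) hc.summable_norm fun p u => S.norm_smul_hop_freeProp_le c p u
  unfold CARAlgebra.hop
  exact continuous_const.smul (((S.continuous_annih _).comp (continuous_freeProp _)).star.mul
    ((S.continuous_annih _).comp (continuous_freeProp _)))

/-- The derivative of the components of an interaction under the evolution of reservoir `I`. -/
lemma hasDerivAt_form {c v : Mode d × Mode d → ℂ} (hc : Tame c) (hv : Tame v)
    (h : HasDerivAt (fun u : ℝ => S.evol Reservoir.I u (S.second c)) (S.second v) 0)
    (r s : Reservoir) (f g : OneParticle d) :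
    HasDerivAt (fun u : ℝ => form c r s (localProp Reservoir.I (-u) r f)
      (localProp Reservoir.I (-u) s g)) (form v r s f g) 0 := by
  -- Any state would do: it only turns multiples of the unit into numbers. The parameters 1 and 0
  -- are arbitrary.
  set ω := S.equilibrium (fun _ => 1) (fun _ => 0)
  have hω : ω 1 = 1 := (S.equilibrium_spec (fun _ => 1) (fun _ => 0) fun _ => one_pos).unit
  set φ : A →L[ℂ] ℂ := ω ∘L S.probe r s f g with hφ
  have e1 : φ (S.second v) = form v r s f g := by
    rw [hφ, ContinuousLinearMap.comp_apply, S.probe_second hv, map_smul, hω, smul_eq_mul, mul_one]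
  have e2 : ∀ u : ℝ, φ (S.evol Reservoir.I u (S.second c)) =
      form c r s (localProp Reservoir.I (-u) r f) (localProp Reservoir.I (-u) s g) := by
    intro u
    have := S.map_second hc (φ ∘L homCLM (S.evol Reservoir.I u))
    simp only [ContinuousLinearMap.comp_apply, homCLM_apply, evol_hop] at this
    rw [this, form]
    refine tsum_congr fun p => ?_
    rw [hφ, ContinuousLinearMap.comp_apply, S.probe_hop, map_smul, hω, smul_eq_mul, smul_eq_mul,
      mul_one, conj_overlap, overlap, inner_localProp_left, inner_localProp_left, neg_neg]
    congr 2
    · split_ifs with h1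
      · rw [h1]
      · rfl
    · split_ifs with h1
      · rw [h1]
      · rfl
  have := (φ.restrictScalars ℝ).hasFDerivAt.comp_hasDerivAt (0 : ℝ) h
  simp only [ContinuousLinearMap.coe_restrictScalars', e1] at this
  refine this.congr_of_eventuallyEq (Eventually.of_forall fun u => ?_)
  exact (e2 u).symm

end FreeReservoirs

/-! ### The currents of order g²ξ² as time integrals of correlations. -/

lemma sum_reservoir {M : Type*} [AddCommMonoid M] (f : Reservoir → M) :
    ∑ r, f r = f Reservoir.I + f Reservoir.II := by
  have : (Finset.univ : Finset Reservoir) = {Reservoir.I, Reservoir.II} := rfl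
  rw [this, Finset.sum_pair (by decide)]

/-- The Fermi function at inverse temperature `β` and chemical potential `μ`. -/
noncomputable def fermi (β μ e : ℝ) : ℂ := ((1 / (Real.exp (β * (e - μ)) + 1) : ℝ) : ℂ)

lemma fermiOp_eq (β μ : ℝ) (f : OneParticle d) : fermiOp β μ f = energyFunction (fermi β μ) f := rfl

lemma fermi_bound (β μ : ℝ) : EnergyBound (fermi β μ) 1 := by
  refine ⟨by unfold fermi; fun_prop, fun e _ => ?_⟩
  rw [fermi, Complex.norm_real, Real.norm_of_nonneg (by positivity), div_le_one (by positivity)]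
  linarith [Real.exp_pos (β * (e - μ))]

lemma conj_fermi (β μ e : ℝ) : starRingEnd ℂ (fermi β μ e) = fermi β μ e := Complex.conj_ofReal _

lemma inner_fermiOp (β μ : ℝ) (f g : OneParticle d) :
    (inner ℂ f (fermiOp β μ g) : ℂ) = inner ℂ (fermiOp β μ f) g := by
  rw [fermiOp_eq, fermiOp_eq, inner_energyFunction_left (fermi_bound β μ)]
  simp only [conj_fermi]

section Transport

variable {c o : Mode d × Mode d → ℂ} {m : ℝ → ℂ} {C : ℝ}

lemma integrable_corr (hd : 3 ≤ d) (hc : Tame c) (ho : Tame o) (hm : EnergyBound m C)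
    (r s : Reservoir) : Integrable (corr c o r s m fun _ => 1) :=
  (integrable_decay.const_mul _).mono' (continuous_corr hc ho hm energyBound_one).aestronglyMeasurable
    (ae_of_all _ fun t => norm_corr_le hd hc ho hm t)

lemma corr_one_eq (hc : Tame c) (ho : Tame o) (hm : EnergyBound m C) (r s : Reservoir) (t : ℝ) :
    corr c o r s (fun _ => 1) m t =
      corr o c s r (fun e => starRingEnd ℂ (m e)) (fun _ => 1) (-t) := by
  simpa using corr_swap (r := r) (s := s) hc ho energyBound_one hm t

lemma integrable_corr_one (hd : 3 ≤ d) (hc : Tame c) (ho : Tame o) (hm : EnergyBound m C)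
    (r s : Reservoir) : Integrable (corr c o r s (fun _ => 1) m) := by
  refine (integrable_corr hd ho hc hm.conj s r).comp_neg.congr (ae_of_all _ fun t => ?_)
  exact (corr_one_eq hc ho hm r s t).symm

/-- The contribution of the particles of reservoir `r` to the stationary current. -/
noncomputable def transport (c o : Mode d × Mode d → ℂ) (r : Reservoir) (m : ℝ → ℂ) : ℂ :=
  ∑ s, ((∫ t in Set.Ioi (0 : ℝ), corr c o r s m (fun _ => 1) t) -
    ∫ t in Set.Ioi (0 : ℝ), corr c o s r (fun _ => 1) m t)

/-- The expectation of the commutator of the evolved interaction with an observable. -/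
noncomputable def response (c o : Mode d × Mode d → ℂ) (m : Reservoir → ℝ → ℂ) (t : ℝ) : ℂ :=
  ∑ r, ∑ s, (corr c o r s (m r) (fun _ => 1) t - corr c o r s (fun _ => 1) (m s) t)

lemma integral_response (hd : 3 ≤ d) (hc : Tame c) (ho : Tame o) {m : Reservoir → ℝ → ℂ}
    (hm : ∀ r, EnergyBound (m r) C) :
    IntegrableOn (response c o m) (Set.Ioi 0) ∧
    ∫ t in Set.Ioi (0 : ℝ), response c o m t = ∑ r, transport c o r (m r) := by
  have h1 : ∀ r s, IntegrableOn (corr c o r s (m r) (fun _ => 1)) (Set.Ioi 0) :=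
    fun r s => (integrable_corr hd hc ho (hm r) r s).integrableOn
  have h2 : ∀ r s, IntegrableOn (corr c o r s (fun _ => 1) (m s)) (Set.Ioi 0) :=
    fun r s => (integrable_corr_one hd hc ho (hm s) r s).integrableOn
  have h3 : ∀ r s, IntegrableOn (fun t => corr c o r s (m r) (fun _ => 1) t -
      corr c o r s (fun _ => 1) (m s) t) (Set.Ioi 0) := fun r s => (h1 r s).sub (h2 r s)
  refine ⟨integrable_finsetSum _ fun r _ => integrable_finsetSum _ fun s _ => h3 r s, ?_⟩
  unfold response transport
  rw [integral_finsetSum _ fun r _ => integrable_finsetSum _ fun s _ => h3 r s]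
  simp_rw [integral_finsetSum _ fun s (_ : s ∈ Finset.univ) => h3 _ s]
  simp_rw [integral_sub (h1 _ _) (h2 _ _), Finset.sum_sub_distrib]
  congr 1
  -- Exchanging r and s in the second sum groups all terms by the reservoir whose Fermi function
  -- they contain.
  rw [Finset.sum_comm]

end Transport

namespace FreeReservoirs

variable (S : FreeReservoirs d A)

lemma equilibrium_commutator {c o : Mode d × Mode d → ℂ} (hc : Tame c) (ho : Tame o)
    {β μ : Reservoir → ℝ} (hβ : ∀ r, 0 < β r) (t : ℝ) :
    S.equilibrium β μ (S.freeEvol (-t) (S.second c) * S.second o -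
      S.second o * S.freeEvol (-t) (S.second c)) =
      response c o (fun r => fermi (β r) (μ r)) t := by
  set T : Reservoir → ℝ → ℂ := fun r => fermi (β r) (μ r) with hT
  have hTb : ∀ r, EnergyBound (T r) 1 := fun r => fermi_bound _ _
  have hs : Summable fun p : Mode d × Mode d => c p • S.hop p.1.1 p.2.1
      (freeProp (-t) (mode p.1.2)) (freeProp (-t) (mode p.2.2)) :=
    Summable.of_norm_bounded hc.summable_norm fun p => S.norm_smul_hop_freeProp_le c p _
  have e1 := (S.equilibrium β μ ∘L ((ContinuousLinearMap.mul ℂ A).flip (S.second o) -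
    ContinuousLinearMap.mul ℂ A (S.second o))).map_tsum hs
  rw [← S.freeEvol_second hc] at e1
  simp only [ContinuousLinearMap.comp_apply, sub_apply, ContinuousLinearMap.mul_apply',
    ContinuousLinearMap.flip_apply, map_smul] at e1
  rw [e1]
  have e0 := S.commutator_hop_second ho (T := fun r => fermiOp (β r) (μ r))
    (S.equilibrium_spec β μ hβ) (fun r => inner_fermiOp _ _)
  simp only [e0]
  unfold response
  have hsum1 : ∀ r s, Summable (corrTerm c o r s (T r) (fun _ => 1) t) :=
    fun r s => summable_corrTerm hc ho (hTb r) energyBound_one t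
  have hsum2 : ∀ r s, Summable (corrTerm c o r s (fun _ => 1) (T s) t) :=
    fun r s => summable_corrTerm hc ho energyBound_one (hTb s) t
  have e2 : ∀ r s, corr c o r s (T r) (fun _ => 1) t - corr c o r s (fun _ => 1) (T s) t =
      ∑' p, (corrTerm c o r s (T r) (fun _ => 1) t p - corrTerm c o r s (fun _ => 1) (T s) t p) :=
    fun r s => ((hsum1 r s).tsum_sub (hsum2 r s)).symm
  simp only [e2]
  simp_rw [← Summable.tsum_finsetSum fun s (_ : s ∈ Finset.univ) => (hsum1 _ s).sub (hsum2 _ s)]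
  rw [← Summable.tsum_finsetSum fun r _ => summable_sum fun s _ => (hsum1 r s).sub (hsum2 r s)]
  refine tsum_congr fun p => ?_
  -- A pair of modes belongs to exactly one component r, s, so the finite double sum collapses.
  have e3 : ∀ r s, corrTerm c o r s (T r) (fun _ => 1) t p - corrTerm c o r s (fun _ => 1) (T s) t p =
      if p.1.1 = r then (if p.2.1 = s then c p * (form o s r (freeProp (-t) (mode p.2.2))
        (fermiOp (β r) (μ r) (freeProp (-t) (mode p.1.2))) -
        form o s r (fermiOp (β s) (μ s) (freeProp (-t) (mode p.2.2)))
          (freeProp (-t) (mode p.1.2))) else 0) else 0 := by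
    intro r s
    unfold corrTerm
    by_cases h1 : p.1.1 = r <;> by_cases h2 : p.2.1 = s <;> simp [h1, h2, evolved_one]
    rw [← mul_sub]
    rfl
  simp only [e3]
  simp [Finset.sum_ite_eq, smul_eq_mul]

/-- The flux takes one power of g and leaves one commutator. The power ξ² is shared by two factors
of order at least one, so both have N = 1; the summand with a two-body flux is an empty sum. -/
lemma expectationTerm_two_two {W O : ℕ → A} {c o : Mode d × Mode d → ℂ} (hc : Tame c) (ho : Tame o)
    (hW : W 1 = S.second c) (hO : O 1 = S.second o) {β μ : Reservoir → ℝ} (hβ : ∀ r, 0 < β r)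
    (t : ℝ) : S.expectationTerm W O 2 2 β μ t =
      Complex.I * ∫ u in (0 : ℝ)..t, response c o (fun r => fermi (β r) (μ r)) u := by
  have h12 : Finset.Icc 1 2 = {1, 2} := rfl
  have hc1 := (S.continuous_freeEvol_second hc).comp continuous_neg
  have hcont : Continuous fun u => S.freeEvol (-u) (S.second c) * S.second o -
      S.second o * S.freeEvol (-u) (S.second c) :=
    (hc1.mul continuous_const).sub (continuous_const.mul hc1)
  simp only [expectationTerm, h12, Finset.sum_pair (by norm_num : (1 : ℕ) ≠ 2), dyson,
    Nat.add_one_sub_one, Nat.sub_self, Finset.Icc_self, Finset.sum_singleton, if_true, hW, hO]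
  norm_num
  rw [← ContinuousLinearMap.intervalIntegral_comp_comm _ (hcont.intervalIntegrable 0 t)]
  exact intervalIntegral.integral_congr fun u _ => S.equilibrium_commutator hc ho hβ u

lemma tendsto_expectationTerm (hd : 3 ≤ d) {W O : ℕ → A} {c o : Mode d × Mode d → ℂ} (hc : Tame c)
    (ho : Tame o) (hW : W 1 = S.second c) (hO : O 1 = S.second o) {β μ : Reservoir → ℝ}
    (hβ : ∀ r, 0 < β r) :
    Tendsto (S.expectationTerm W O 2 2 β μ) atTop
      (𝓝 (Complex.I * ∑ r, transport c o r (fermi (β r) (μ r)))) := by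
  obtain ⟨h1, h2⟩ := integral_response hd hc ho (m := fun r => fermi (β r) (μ r))
    fun r => fermi_bound _ _
  rw [show S.expectationTerm W O 2 2 β μ = _ from
    funext (S.expectationTerm_two_two hc ho hW hO hβ), ← h2]
  exact (intervalIntegral_tendsto_integral_Ioi 0 h1 tendsto_id).const_mul _

end FreeReservoirs

/-! ### The net transport functional and its relation to both currents. -/

section Functional

variable {c v : Mode d × Mode d → ℂ} {m : ℝ → ℂ} {C C' C₁ C₂ : ℝ}

/-- The transport of a quantity distributed in energy like `m` by the particles of
reservoir `II`. -/
noncomputable def netTransport (c : Mode d × Mode d → ℂ) (m : ℝ → ℂ) : ℂ :=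
  (∫ t in Set.Ioi (0 : ℝ), corr c c Reservoir.II Reservoir.I m (fun _ => 1) t) +
    ∫ t in Set.Ioi (0 : ℝ), corr c c Reservoir.II Reservoir.I m (fun _ => 1) (-t)

lemma netTransport_add (hd : 3 ≤ d) (hc : Tame c) {m' : ℝ → ℂ} (hm : EnergyBound m C)
    (hm' : EnergyBound m' C') :
    netTransport c (fun e => m e + m' e) = netTransport c m + netTransport c m' := by
  have h1 := integrable_corr hd hc hc hm Reservoir.II Reservoir.I
  have h2 := integrable_corr hd hc hc hm' Reservoir.II Reservoir.I
  unfold netTransport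
  simp only [corr_add_fun hc hc hm hm' energyBound_one]
  rw [integral_add h1.integrableOn h2.integrableOn,
    integral_add h1.comp_neg.integrableOn h2.comp_neg.integrableOn]
  ring

lemma netTransport_const_mul (hm : EnergyBound m C) (z : ℂ) :
    netTransport c (fun e => z * m e) = z * netTransport c m := by
  unfold netTransport
  simp only [corr_const_mul hm, integral_const_mul]
  ring

lemma norm_netTransport_le (hd : 3 ≤ d) (hc : Tame c) (hm : EnergyBound m C) :
    ‖netTransport c m‖ ≤
      2 * (tameNorm c * tameNorm c * ∫ t in Set.Ioi (0 : ℝ), decay t) * C := by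
  have h1 : ‖∫ t in Set.Ioi (0 : ℝ), corr c c Reservoir.II Reservoir.I m (fun _ => 1) t‖ ≤
      ∫ t in Set.Ioi (0 : ℝ), tameNorm c * (tameNorm c * C) * decay t :=
    norm_integral_le_of_norm_le (integrable_decay.const_mul _).integrableOn
      (ae_of_all _ fun t => norm_corr_le hd hc hc hm t)
  have h2 : ‖∫ t in Set.Ioi (0 : ℝ), corr c c Reservoir.II Reservoir.I m (fun _ => 1) (-t)‖ ≤
      ∫ t in Set.Ioi (0 : ℝ), tameNorm c * (tameNorm c * C) * decay t :=
    norm_integral_le_of_norm_le (integrable_decay.const_mul _).integrableOn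
      (ae_of_all _ fun t => by
        have := norm_corr_le hd hc hc hm (r := Reservoir.II) (s := Reservoir.I) (-t)
        rwa [decay_neg] at this)
  rw [integral_const_mul] at h1 h2
  refine (norm_add_le_of_le h1 h2).trans (le_of_eq ?_)
  ring

/-- Linearity and the sup-norm bound turn a quadratic remainder that is uniform in the energy into a
quadratic remainder of the functional. -/
lemma hasDerivAt_netTransport (hd : 3 ≤ d) (hc : Tame c) {m : ℝ → ℝ → ℂ} {m' : ℝ → ℂ} {δ : ℝ}
    (hδ : 0 < δ) (hm : ∀ x, |x| < δ → ∃ C₀, EnergyBound (m x) C₀) (hm' : EnergyBound m' C₁)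
    (h : ∀ x, |x| < δ → ∀ e, 0 ≤ e → ‖m x e - m 0 e - x * m' e‖ ≤ C * x ^ 2) :
    HasDerivAt (fun x => netTransport c (m x)) (netTransport c m') 0 := by
  rw [hasDerivAt_iff_isLittleO]
  have hO : (fun x : ℝ => netTransport c (m x) - netTransport c (m 0) -
      (x - 0) • netTransport c m') =O[𝓝 0] fun x => (x - 0) ^ 2 := by
    refine Asymptotics.IsBigO.of_bound
      (2 * (tameNorm c * tameNorm c * ∫ t in Set.Ioi (0 : ℝ), decay t) * C) ?_
    filter_upwards [Metric.ball_mem_nhds (0 : ℝ) hδ] with x hx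
    have hx' : |x| < δ := by simpa using hx
    obtain ⟨C₀, h0⟩ := hm 0 (by simpa using hδ)
    obtain ⟨Cx, hmx⟩ := hm x hx'
    have e1 : netTransport c (m x) - netTransport c (m 0) - (x - 0) • netTransport c m' =
        netTransport c (fun e => m x e + ((-1) * m 0 e + (-(x : ℂ)) * m' e)) := by
      rw [netTransport_add hd hc hmx ((h0.const_mul _).add (hm'.const_mul _)),
        netTransport_add hd hc (h0.const_mul _) (hm'.const_mul _), netTransport_const_mul h0,
        netTransport_const_mul hm', sub_zero, Complex.real_smul]
      ring
    rw [e1, sub_zero, Real.norm_of_nonneg (sq_nonneg _), mul_assoc]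
    refine norm_netTransport_le hd hc
      ⟨(hmx.1.add ((h0.1.const_mul _).add (hm'.1.const_mul _))), fun e he => ?_⟩
    have := h x hx' e he
    rwa [show m x e - m 0 e - x * m' e = m x e + ((-1) * m 0 e + (-(x : ℂ)) * m' e) by ring]
      at this
  refine hO.trans_isLittleO ?_
  simpa using Asymptotics.isLittleO_pow_sub_sub (0 : ℝ) (one_lt_two : 1 < 2)

/-- Without a II–II component of the flux, only the exchange with reservoir I is left in each half
of the commutator. -/
lemma transport_of_form_eq {o o' : Mode d × Mode d → ℂ} (hII : ∀ f g, form o Reservoir.II Reservoir.II f g = 0)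
    {z z' : ℂ}
    (h12 : ∀ f g, form o Reservoir.I Reservoir.II f g = z * form o' Reservoir.I Reservoir.II f g)
    (h21 : ∀ f g, form o Reservoir.II Reservoir.I f g = z' * form o' Reservoir.II Reservoir.I f g)
    (m : ℝ → ℂ) :
    transport c o Reservoir.II m =
      z * (∫ t in Set.Ioi (0 : ℝ), corr c o' Reservoir.II Reservoir.I m (fun _ => 1) t) -
      z' * ∫ t in Set.Ioi (0 : ℝ), corr c o' Reservoir.I Reservoir.II (fun _ => 1) m t := by
  have h0 : ∀ m n t, corr c o Reservoir.II Reservoir.II m n t = 0 := by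
    intro m n t
    have := corr_congr_right (a := c) (o := o) (o' := o) (r := Reservoir.II) (s := Reservoir.II)
      (m := m) (n := n) (z := 0) (fun f g => by rw [hII, zero_mul]) t
    rw [this, zero_mul]
  rw [transport, sum_reservoir]
  simp only [h0, integral_zero, sub_zero, add_zero, corr_congr_right h12, corr_congr_right h21,
    integral_const_mul]

lemma corr_one_eq_of_real (hc : Tame c) (hm : EnergyBound m C)
    (hreal : ∀ e, starRingEnd ℂ (m e) = m e) (t : ℝ) :
    corr c c Reservoir.I Reservoir.II (fun _ => 1) m t =
      corr c c Reservoir.II Reservoir.I m (fun _ => 1) (-t) := by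
  rw [corr_one_eq hc hc hm]
  simp only [hreal]

/-- The coefficients of the particle flux. -/
noncomputable def particleCoeff (c : Mode d × Mode d → ℂ) (p : Mode d × Mode d) : ℂ :=
  -(Complex.I * (charge p.1.1 - charge p.2.1 : ℝ) * c p)

lemma Tame.particleCoeff (hc : Tame c) : Tame (particleCoeff c) := by
  refine hc.mono (C := 1) ?_
  rintro ⟨⟨r, q⟩, ⟨s, q'⟩⟩
  cases r <;> cases s <;> simp [FermiJunction.particleCoeff, charge]

lemma form_particleCoeff (r s : Reservoir) (f g : OneParticle d) :
    form (particleCoeff c) r s f g =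
      -(Complex.I * (charge r - charge s : ℝ)) * form c r s f g := by
  refine form_const_mul c r s (fun p hr hs => ?_) f g
  rw [particleCoeff, hr, hs, neg_mul]

/-- The particle current carried by the particles of reservoir `II`. -/
lemma transport_particleCoeff (hc : Tame c) (hm : EnergyBound m C)
    (hreal : ∀ e, starRingEnd ℂ (m e) = m e) :
    Complex.I * transport c (particleCoeff c) Reservoir.II m = netTransport c m := by
  rw [transport_of_form_eq (o' := c) (fun f g => by rw [form_particleCoeff]; simp)
    (form_particleCoeff _ _) (form_particleCoeff _ _)]
  simp only [corr_one_eq_of_real hc hm hreal, charge, netTransport]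
  -- The factors are -i for the component I, II and +i for II, I. The outer factor i therefore turns
  -- the difference of half-line integrals into their sum.
  have hI := Complex.I_mul_I
  push_cast
  linear_combination (-(∫ t in Set.Ioi (0 : ℝ), corr c c Reservoir.II Reservoir.I m (fun _ => 1) t) -
    ∫ t in Set.Ioi (0 : ℝ), corr c c Reservoir.II Reservoir.I m (fun _ => 1) (-t)) * hI

lemma tendsto_corr_atTop (hd : 3 ≤ d) (hc : Tame c) (hm : EnergyBound m C) (r s : Reservoir) :
    Tendsto (corr c c r s m fun _ => 1) atTop (𝓝 0) := by
  refine squeeze_zero_norm (fun t => norm_corr_le hd hc hc hm t) ?_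
  simpa using tendsto_decay_atTop.const_mul (tameNorm c * (tameNorm c * C))

lemma tendsto_corr_one_atTop (hd : 3 ≤ d) (hc : Tame c) (hm : EnergyBound m C) (r s : Reservoir) :
    Tendsto (corr c c r s (fun _ => 1) m) atTop (𝓝 0) := by
  refine squeeze_zero_norm (fun t => ?_)
    (by simpa using tendsto_decay_atTop.const_mul (tameNorm c * (tameNorm c * C)))
  rw [corr_one_eq hc hc hm]
  have := norm_corr_le hd hc hc hm.conj (r := s) (s := r) (-t)
  rwa [decay_neg] at this

/-- The energy current carried by the particles of reservoir `II`. -/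
lemma transport_energy (hd : 3 ≤ d) (hc : Tame c) (hv : Tame v) (h0 : EnergyBound m C)
    (h1 : EnergyBound (fun e => (e : ℂ) * m e) C₁)
    (h2 : ∀ e, 0 ≤ e → e ^ 2 * ‖m e‖ ≤ C₂) (hreal : ∀ e, starRingEnd ℂ (m e) = m e)
    (h12 : ∀ f g, HasDerivAt (fun u : ℝ => form c Reservoir.I Reservoir.II (freeProp (-u) f) g)
      (form v Reservoir.I Reservoir.II f g) 0)
    (h21 : ∀ f g, HasDerivAt (fun u : ℝ => form c Reservoir.II Reservoir.I f (freeProp (-u) g))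
      (form v Reservoir.II Reservoir.I f g) 0)
    (h22 : ∀ f g, form v Reservoir.II Reservoir.II f g = 0) :
    Complex.I * transport c (fun p => -1 * v p) Reservoir.II m =
      netTransport c fun e => (e : ℂ) * m e := by
  have hneg : ∀ r s f g, form (fun p => -1 * v p) r s f g = -1 * form v r s f g :=
    fun r s f g => form_const_mul v r s (fun p _ _ => rfl) f g
  rw [transport_of_form_eq (o' := v) (fun f g => by rw [hneg, h22, mul_zero]) (hneg _ _)
    (hneg _ _)]
  have hfun : (fun e : ℝ => -Complex.I * (e : ℂ) * m e) =
      fun e : ℝ => -Complex.I * ((e : ℂ) * m e) := funext fun e => mul_assoc _ _ _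
  have hconj : (fun e : ℝ => starRingEnd ℂ (-Complex.I * (e : ℂ) * m e)) =
      fun e : ℝ => Complex.I * ((e : ℂ) * m e) := by
    funext e; simp [hreal, mul_assoc]
  have h1' : EnergyBound (fun e => -Complex.I * (e : ℂ) * m e) C₁ := by
    rw [hfun]; simpa using h1.const_mul (-Complex.I)
  set G := corr c c Reservoir.II Reservoir.I (fun e => (e : ℂ) * m e) (fun _ => 1) with hG
  have hGi : Integrable G := integrable_corr hd hc hc h1 _ _
  have hvi := integrable_corr hd hc hv h0 Reservoir.II Reservoir.I
  have hvi' := integrable_corr_one hd hc hv h0 Reservoir.I Reservoir.II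
  -- The integrand is a total time derivative: the term with v comes from the leg of reservoir I,
  -- the term with the energy from that of reservoir II. At infinity the correlation vanishes by
  -- `norm_corr_le`.
  have e1 : (∫ t in Set.Ioi (0 : ℝ), corr c v Reservoir.II Reservoir.I m (fun _ => 1) t) +
      -Complex.I * (∫ t in Set.Ioi (0 : ℝ), G t) =
      0 - corr c c Reservoir.II Reservoir.I m (fun _ => 1) 0 := by
    rw [← integral_const_mul, ← integral_add hvi.integrableOn (hGi.const_mul _).integrableOn]
    refine integral_Ioi_of_hasDerivAt_of_tendsto' (fun t _ => ?_)
      (hvi.add (hGi.const_mul _)).integrableOn (tendsto_corr_atTop hd hc h0 _ _)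
    have := hasDerivAt_corr_left hc hc hv h0 h1' h2 h12 t
    rwa [hfun, corr_const_mul h1] at this
  have e2 : (∫ t in Set.Ioi (0 : ℝ), corr c v Reservoir.I Reservoir.II (fun _ => 1) m t) +
      Complex.I * (∫ t in Set.Ioi (0 : ℝ), G (-t)) =
      0 - corr c c Reservoir.I Reservoir.II (fun _ => 1) m 0 := by
    rw [← integral_const_mul, ← integral_add hvi'.integrableOn
      (hGi.comp_neg.const_mul _).integrableOn]
    refine integral_Ioi_of_hasDerivAt_of_tendsto' (fun t _ => ?_)
      (hvi'.add (hGi.comp_neg.const_mul _)).integrableOn (tendsto_corr_one_atTop hd hc h0 _ _)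
    have := hasDerivAt_corr_right hc hc hv h0 h1' h2 h21 t
    rwa [corr_one_eq hc hc h1', hconj, corr_const_mul h1] at this
  -- By cyclicity the boundary value at t = 0 is the same as in `e1`, so it drops out of the
  -- difference.
  rw [corr_one_eq_of_real hc h0 hreal, neg_zero] at e2
  have hI := Complex.I_mul_I
  unfold netTransport
  linear_combination Complex.I * e2 - Complex.I * e1 +
    (-(∫ t in Set.Ioi (0 : ℝ), G t) - ∫ t in Set.Ioi (0 : ℝ), G (-t)) * hI

end Functional

/-! ### Uniform Taylor estimates for the Fermi function. -/

section FermiFunction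

/-- The Fermi function of a dimensionless energy. -/
noncomputable def sigmoid (y : ℝ) : ℝ := 1 / (Real.exp y + 1)

/-- The derivative of `sigmoid`. -/
noncomputable def sigmoidDeriv (y : ℝ) : ℝ := -(Real.exp y / (Real.exp y + 1) ^ 2)

lemma sigmoid_nonneg (y : ℝ) : 0 ≤ sigmoid y := by unfold sigmoid; positivity

lemma sigmoid_le_one (y : ℝ) : sigmoid y ≤ 1 := by
  rw [sigmoid, div_le_one (by positivity)]; linarith [Real.exp_pos y]

lemma sigmoid_le_exp_neg (y : ℝ) : sigmoid y ≤ Real.exp (-y) := by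
  rw [sigmoid, Real.exp_neg, one_div]
  exact inv_anti₀ (Real.exp_pos y) (by linarith)

lemma abs_sigmoidDeriv_le (y : ℝ) : |sigmoidDeriv y| ≤ Real.exp (-y) := by
  have := Real.exp_pos y
  rw [sigmoidDeriv, abs_neg, abs_of_pos (by positivity), Real.exp_neg, div_le_iff₀ (by positivity),
    inv_mul_eq_div, le_div_iff₀ this]
  nlinarith

lemma abs_exp_sub_one_sub_le (z : ℝ) : |Real.exp z - 1 - z| ≤ z ^ 2 * Real.exp |z| := by
  have h := Complex.norm_exp_sub_sum_le_norm_mul_exp (z : ℂ) 2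
  have e : Complex.exp z - ∑ m ∈ Finset.range 2, (z : ℂ) ^ m / (m.factorial : ℂ) =
      ((Real.exp z - 1 - z : ℝ) : ℂ) := by
    simp [Finset.sum_range_succ]
    ring
  rw [e, Complex.norm_real, Complex.norm_real, Real.norm_eq_abs, Real.norm_eq_abs, sq_abs] at h
  exact h

/-- With E = e^y and q = e^z the remainder is E/(E+1)² times a combination, with weights 1/(Eq+1)
and Eq/(Eq+1) and up to signs, of the second-order remainders of exp at z and at -z. The resulting
factor e^{-y} later absorbs powers of the energy. -/
lemma abs_sigmoid_taylor_le (y z : ℝ) :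
    |sigmoid (y + z) - sigmoid y - z * sigmoidDeriv y| ≤ z ^ 2 * Real.exp (|z| - y) := by
  set E := Real.exp y with hE
  set q := Real.exp z with hq
  have hE0 : 0 < E := Real.exp_pos y
  have hq0 : 0 < q := Real.exp_pos z
  have e1 : sigmoid (y + z) - sigmoid y - z * sigmoidDeriv y =
      E / (E + 1) ^ 2 * ((-(q - 1 - z) + E * (q * (Real.exp (-z) - 1 - -z))) / (E * q + 1)) := by
    have h1 : q * Real.exp (-z) = 1 := by rw [hq, ← Real.exp_add]; simp
    rw [sigmoid, sigmoid, sigmoidDeriv, Real.exp_add, ← hE, ← hq,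
      show q * (Real.exp (-z) - 1 - -z) = 1 - q + q * z by
        linear_combination h1]
    field_simp
    ring
  have h1 := abs_exp_sub_one_sub_le z
  have h2 := abs_exp_sub_one_sub_le (-z)
  rw [abs_neg, neg_sq] at h2
  set M := z ^ 2 * Real.exp |z| with hM
  have h3 : |(-(q - 1 - z) + E * (q * (Real.exp (-z) - 1 - -z))) / (E * q + 1)| ≤ M := by
    rw [abs_div, abs_of_pos (by positivity : 0 < E * q + 1), div_le_iff₀ (by positivity)]
    refine (abs_add_le _ _).trans ?_
    rw [abs_neg, abs_mul, abs_mul, abs_of_pos hE0, abs_of_pos hq0]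
    have : E * (q * |Real.exp (-z) - 1 - -z|) ≤ E * (q * M) := by gcongr
    linarith
  have h4 : E / (E + 1) ^ 2 ≤ Real.exp (-y) := by
    have := abs_sigmoidDeriv_le y
    rwa [sigmoidDeriv, abs_neg, abs_of_pos (by positivity)] at this
  rw [e1, abs_mul, abs_of_pos (by positivity : 0 < E / (E + 1) ^ 2)]
  calc _ ≤ Real.exp (-y) * M := mul_le_mul h4 h3 (abs_nonneg _) (Real.exp_pos _).le
    _ = _ := by rw [hM, Real.exp_sub, Real.exp_neg]; ring

lemma mul_exp_neg_le {β e : ℝ} (hβ : 0 < β) : e * Real.exp (-(β * e)) ≤ 1 / β := by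
  have h := Real.add_one_le_exp (β * e)
  rw [Real.exp_neg, ← div_eq_mul_inv, div_le_div_iff₀ (Real.exp_pos _) hβ]
  nlinarith

lemma sq_mul_exp_neg_le {β e : ℝ} (hβ : 0 < β) (he : 0 ≤ e) :
    e ^ 2 * Real.exp (-(β * e)) ≤ 2 / β ^ 2 := by
  have h := Real.quadratic_le_exp_of_nonneg (mul_nonneg hβ.le he)
  rw [Real.exp_neg, ← div_eq_mul_inv, div_le_div_iff₀ (Real.exp_pos _) (by positivity)]
  nlinarith [mul_nonneg hβ.le he]

lemma fermi_eq_sigmoid (β μ e : ℝ) : fermi β μ e = (sigmoid (β * e - β * μ) : ℝ) := by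
  rw [fermi, sigmoid, mul_sub]

lemma measurable_sigmoid : Measurable sigmoid := by unfold sigmoid; fun_prop

lemma measurable_sigmoidDeriv : Measurable sigmoidDeriv := by unfold sigmoidDeriv; fun_prop

lemma energy_mul_sigmoid_bound {β : ℝ} (hβ : 0 < β) (ν : ℝ) :
    EnergyBound (fun e => (e : ℂ) * (sigmoid (β * e - ν) : ℝ)) (Real.exp ν * (1 / β)) := by
  refine ⟨Complex.measurable_ofReal.mul (Complex.measurable_ofReal.comp
    (measurable_sigmoid.comp (by fun_prop))), fun e he => ?_⟩
  rw [norm_mul, Complex.norm_real, Complex.norm_real, Real.norm_of_nonneg he,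
    Real.norm_of_nonneg (sigmoid_nonneg _)]
  calc _ ≤ e * Real.exp (-(β * e - ν)) := by gcongr; exact sigmoid_le_exp_neg _
    _ = Real.exp ν * (e * Real.exp (-(β * e))) := by
      rw [neg_sub, Real.exp_sub, Real.exp_neg]; ring
    _ ≤ _ := mul_le_mul_of_nonneg_left (mul_exp_neg_le hβ) (Real.exp_pos _).le

lemma energy_mul_sigmoidDeriv_bound {β : ℝ} (hβ : 0 < β) (ν : ℝ) :
    EnergyBound (fun e => (e : ℂ) * (sigmoidDeriv (β * e - ν) : ℝ)) (Real.exp ν * (1 / β)) := by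
  refine ⟨Complex.measurable_ofReal.mul (Complex.measurable_ofReal.comp
    (measurable_sigmoidDeriv.comp (by fun_prop))), fun e he => ?_⟩
  rw [norm_mul, Complex.norm_real, Complex.norm_real, Real.norm_of_nonneg he, Real.norm_eq_abs]
  calc _ ≤ e * Real.exp (-(β * e - ν)) := by gcongr; exact abs_sigmoidDeriv_le _
    _ = Real.exp ν * (e * Real.exp (-(β * e))) := by
      rw [neg_sub, Real.exp_sub, Real.exp_neg]; ring
    _ ≤ _ := mul_le_mul_of_nonneg_left (mul_exp_neg_le hβ) (Real.exp_pos _).le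

lemma energy_mul_fermi_bound {β : ℝ} (hβ : 0 < β) (μ : ℝ) :
    EnergyBound (fun e => (e : ℂ) * fermi β μ e) (Real.exp (β * μ) * (1 / β)) := by
  simpa only [fermi_eq_sigmoid] using energy_mul_sigmoid_bound hβ (β * μ)

lemma energy_sq_mul_fermi_le {β : ℝ} (hβ : 0 < β) (μ e : ℝ) (he : 0 ≤ e) :
    e ^ 2 * ‖fermi β μ e‖ ≤ Real.exp (β * μ) * (2 / β ^ 2) := by
  rw [fermi_eq_sigmoid, Complex.norm_real, Real.norm_of_nonneg (sigmoid_nonneg _)]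
  calc _ ≤ e ^ 2 * Real.exp (-(β * e - β * μ)) := by gcongr; exact sigmoid_le_exp_neg _
    _ = Real.exp (β * μ) * (e ^ 2 * Real.exp (-(β * e))) := by
      rw [neg_sub, Real.exp_sub, Real.exp_neg]; ring
    _ ≤ _ := mul_le_mul_of_nonneg_left (sq_mul_exp_neg_le hβ he) (Real.exp_pos _).le

variable {c : Mode d × Mode d → ℂ}

lemma hasDerivAt_netTransport_energy (hd : 3 ≤ d) (hc : Tame c) {β : ℝ} (hβ : 0 < β) (ν : ℝ) :
    HasDerivAt (fun x : ℝ => netTransport c fun e => (e : ℂ) * (sigmoid (β * e - (ν - x)) : ℝ))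
      (netTransport c fun e => (e : ℂ) * (sigmoidDeriv (β * e - ν) : ℝ)) 0 := by
  refine hasDerivAt_netTransport (C := Real.exp (1 + ν) * (1 / β)) hd hc one_pos
    (fun x _ => ⟨_, energy_mul_sigmoid_bound hβ (ν - x)⟩) (energy_mul_sigmoidDeriv_bound hβ ν)
    fun x hx e he => ?_
  have e1 : (e : ℂ) * (sigmoid (β * e - (ν - x)) : ℝ) - e * (sigmoid (β * e - (ν - 0)) : ℝ) -
      x * (e * (sigmoidDeriv (β * e - ν) : ℝ)) =
      ((e * (sigmoid ((β * e - ν) + x) - sigmoid (β * e - ν) - x * sigmoidDeriv (β * e - ν)) : ℝ) :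
        ℂ) := by
    rw [sub_zero, show β * e - (ν - x) = (β * e - ν) + x by ring]
    push_cast
    ring
  rw [e1, Complex.norm_real, norm_mul, Real.norm_of_nonneg he, Real.norm_eq_abs]
  calc _ ≤ e * (x ^ 2 * Real.exp (|x| - (β * e - ν))) := by
        gcongr; exact abs_sigmoid_taylor_le _ _
    -- Here |x| < 1, the radius chosen above, which is the origin of the constant e^{1+ν}.
    _ ≤ e * (x ^ 2 * Real.exp ((1 + ν) + -(β * e))) := by gcongr; linarith
    _ = Real.exp (1 + ν) * (e * Real.exp (-(β * e))) * x ^ 2 := by rw [Real.exp_add]; ring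
    _ ≤ _ := by gcongr; exact mul_exp_neg_le hβ

lemma hasDerivAt_netTransport_particle (hd : 3 ≤ d) (hc : Tame c) {β : ℝ} (hβ : 0 < β) (ν : ℝ) :
    HasDerivAt (fun x : ℝ => netTransport c fun e => ((sigmoid ((β - x) * e - ν) : ℝ) : ℂ))
      (netTransport c fun e => (-1 : ℂ) * ((e : ℂ) * (sigmoidDeriv (β * e - ν) : ℝ))) 0 := by
  -- The increment of the argument is xe, unbounded in e. The radius β/2 keeps e^{|x|e - βe} ≤
  -- e^{-βe/2}, which still controls e².
  refine hasDerivAt_netTransport (C := Real.exp ν * (2 / (β / 2) ^ 2)) hd hc (half_pos hβ)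
    (fun x _ => ⟨1, Complex.measurable_ofReal.comp (measurable_sigmoid.comp (by fun_prop)),
      fun e _ => ?_⟩) ((energy_mul_sigmoidDeriv_bound hβ ν).const_mul _) fun x hx e he => ?_
  · rw [Complex.norm_real, Real.norm_of_nonneg (sigmoid_nonneg _)]
    exact sigmoid_le_one _
  have e1 : ((sigmoid ((β - x) * e - ν) : ℝ) : ℂ) - (sigmoid ((β - 0) * e - ν) : ℝ) -
      x * ((-1 : ℂ) * ((e : ℂ) * (sigmoidDeriv (β * e - ν) : ℝ))) =
      ((sigmoid ((β * e - ν) + -(x * e)) - sigmoid (β * e - ν) -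
        -(x * e) * sigmoidDeriv (β * e - ν) : ℝ) : ℂ) := by
    rw [sub_zero, show (β - x) * e - ν = (β * e - ν) + -(x * e) by ring]
    push_cast
    ring
  rw [e1, Complex.norm_real, Real.norm_eq_abs]
  refine (abs_sigmoid_taylor_le _ _).trans ?_
  rw [abs_neg, abs_mul, abs_of_nonneg he]
  calc _ ≤ (-(x * e)) ^ 2 * Real.exp (ν + -(β / 2 * e)) := by
        gcongr
        nlinarith
    _ = Real.exp ν * (e ^ 2 * Real.exp (-(β / 2 * e))) * x ^ 2 := by rw [Real.exp_add]; ring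
    _ ≤ _ := by gcongr; exact sq_mul_exp_neg_le (half_pos hβ) he

end FermiFunction

/-! ### The stationary currents and the reciprocity relation. -/

namespace FreeReservoirs

variable (S : FreeReservoirs d A)

lemma particleFlux_second {c : Mode d × Mode d → ℂ} (hc : Tame c) :
    S.particleFlux (S.second c) = S.second (particleCoeff c) := by
  rw [particleFlux, (S.hasDerivAt_gauge_second hc).deriv, CARAlgebra.second, ← tsum_neg]
  simp only [CARAlgebra.second, particleCoeff, neg_smul]

lemma energyFlux_second {c v : Mode d × Mode d → ℂ}
    (h : HasDerivAt (fun u : ℝ => S.evol Reservoir.I u (S.second c)) (S.second v) 0) :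
    S.energyFlux (S.second c) = S.second fun p => -1 * v p := by
  rw [energyFlux, h.deriv, CARAlgebra.second, ← tsum_neg]
  simp only [CARAlgebra.second, neg_smul, neg_mul, one_mul]

variable {w : ∀ N : ℕ, Kernel d N}

/-- The part carried by reservoir I is left unevaluated, since it does not depend on Δβ and Δν. -/
lemma tendsto_particleCurrentAt (hd : 3 ≤ d) (hw : (w 1).HasFiniteNorm) {β μ : Reservoir → ℝ}
    (hβ : ∀ r, 0 < β r) :
    Tendsto (S.particleCurrentAt w 2 2 β μ) atTop
      (𝓝 (Complex.I * transport (kernelCoeff (w 1)) (particleCoeff (kernelCoeff (w 1))) Reservoir.I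
        (fermi (β Reservoir.I) (μ Reservoir.I)) +
        netTransport (kernelCoeff (w 1)) (fermi (β Reservoir.II) (μ Reservoir.II)))) := by
  have h := S.tendsto_expectationTerm hd hw.tame hw.tame.particleCoeff (W := S.interaction w)
    (O := fun N => S.particleFlux (S.interaction w N)) (S.quantize_eq_second (w 1))
    (by rw [interaction, S.quantize_eq_second, S.particleFlux_second hw.tame]) (μ := μ) hβ
  rwa [sum_reservoir, mul_add, transport_particleCoeff hw.tame (fermi_bound _ _)
    (conj_fermi _ _)] at h

lemma tendsto_energyCurrentAt (hd : 3 ≤ d) (hw : (w 1).HasFiniteNorm) {v : Kernel d 1}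
    (hv : v.HasFiniteNorm)
    (h : HasDerivAt (fun s : ℝ => S.evol Reservoir.I s (S.interaction w 1)) (S.quantize v) 0)
    {β μ : Reservoir → ℝ} (hβ : ∀ r, 0 < β r) :
    Tendsto (S.energyCurrentAt w 2 2 β μ) atTop
      (𝓝 (Complex.I * transport (kernelCoeff (w 1)) (fun p => -1 * kernelCoeff v p) Reservoir.I
        (fermi (β Reservoir.I) (μ Reservoir.I)) +
        netTransport (kernelCoeff (w 1))
          fun e => (e : ℂ) * fermi (β Reservoir.II) (μ Reservoir.II) e)) := by
  simp only [interaction, S.quantize_eq_second] at h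
  have hform := S.hasDerivAt_form hw.tame hv.tame h
  have hlim := S.tendsto_expectationTerm hd hw.tame (hv.tame.mono (c' := fun p => -1 * kernelCoeff v p)
    (C := 1) fun p => by simp) (W := S.interaction w)
    (O := fun N => S.energyFlux (S.interaction w N)) (S.quantize_eq_second (w 1))
    (by rw [interaction, S.quantize_eq_second, S.energyFlux_second h]) (μ := μ) hβ
  rwa [sum_reservoir, mul_add, transport_energy hd hw.tame hv.tame (fermi_bound _ _)
    (energy_mul_fermi_bound (hβ _) _) (energy_sq_mul_fermi_le (hβ _) _) (conj_fermi _ _)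
    (fun f g => by simpa [localProp] using hform Reservoir.I Reservoir.II f g)
    (fun f g => by simpa [localProp] using hform Reservoir.II Reservoir.I f g)
    -- The evolution of reservoir I leaves the II–II component fixed, so uniqueness of derivatives
    -- forces the energy flux to vanish there.
    (fun f g => ((hasDerivAt_const (0 : ℝ) (form (kernelCoeff (w 1)) Reservoir.II Reservoir.II f
      g)).unique (by simpa [localProp] using hform Reservoir.II Reservoir.II f g)).symm)] at hlim

end FreeReservoirs

/-- Δβ < β gives β^II ≠ 0, so that β^II μ^II = ν - Δν and the Fermi function depends on (β-Δβ)e -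
(ν-Δν) alone. -/
lemma fermi_chemPot {β ν Δβ Δν : ℝ} (h : Δβ < β) :
    fermi (invTemp β Δβ Reservoir.II) (chemPot β ν Δβ Δν Reservoir.II) =
      fun e => ((sigmoid ((β - Δβ) * e - (ν - Δν)) : ℝ) : ℂ) := by
  funext e
  rw [fermi_eq_sigmoid, invTemp, chemPot, mul_div_cancel₀ _ (sub_pos.2 h).ne']

lemma invTemp_pos {β Δβ : ℝ} (hβ : 0 < β) (h : Δβ < β) (r : Reservoir) : 0 < invTemp β Δβ r := by
  cases r
  · exact hβ
  · exact sub_pos.2 h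

end FermiJunction

theorem mainTheorem5 {d : ℕ} (hd : 3 ≤ d) {A : Type*} [CStarAlgebra A]
    (S : FermiJunction.FreeReservoirs d A)
    (w : ∀ N : ℕ, FermiJunction.Kernel d N)
    (hw : ∀ N : ℕ, 1 ≤ N → (w N).HasFiniteNorm)
    (hsa : ∀ N : ℕ, 1 ≤ N → IsSelfAdjoint (S.interaction w N))
    (henergy : ∀ N : ℕ, 1 ≤ N → ∃ v : FermiJunction.Kernel d N, v.HasFiniteNorm ∧
      HasDerivAt (fun s : ℝ => S.evol FermiJunction.Reservoir.I s (S.interaction w N))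
        (S.quantize v) 0) :
    (∀ β μ : FermiJunction.Reservoir → ℝ, (∀ r, 0 < β r) →
      Tendsto (S.particleCurrentAt w 2 2 β μ) atTop (𝓝 (S.particleCurrent w 2 2 β μ)) ∧
      Tendsto (S.energyCurrentAt w 2 2 β μ) atTop (𝓝 (S.energyCurrent w 2 2 β μ))) ∧
    ∀ β ν : ℝ, 0 < β →
      DifferentiableAt ℝ (fun Δν : ℝ => S.energyCurrent w 2 2
        (FermiJunction.invTemp β 0) (FermiJunction.chemPot β ν 0 Δν)) 0 ∧
      DifferentiableAt ℝ (fun Δβ : ℝ => S.particleCurrent w 2 2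
        (FermiJunction.invTemp β Δβ) (FermiJunction.chemPot β ν Δβ 0)) 0 ∧
      deriv (fun Δν : ℝ => S.energyCurrent w 2 2
        (FermiJunction.invTemp β 0) (FermiJunction.chemPot β ν 0 Δν)) 0 =
      -deriv (fun Δβ : ℝ => S.particleCurrent w 2 2
        (FermiJunction.invTemp β Δβ) (FermiJunction.chemPot β ν Δβ 0)) 0 := by
  have hw1 := hw 1 le_rfl
  obtain ⟨v, hv, hderiv⟩ := henergy 1 le_rfl
  have hJ := fun (β μ : FermiJunction.Reservoir → ℝ) (hβ : ∀ r, 0 < β r) =>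
    S.tendsto_particleCurrentAt hd hw1 (μ := μ) hβ
  have hP := fun (β μ : FermiJunction.Reservoir → ℝ) (hβ : ∀ r, 0 < β r) =>
    S.tendsto_energyCurrentAt hd hw1 hv hderiv (μ := μ) hβ
  refine ⟨fun β μ hβ => ⟨tendsto_nhds_limUnder ⟨_, hJ β μ hβ⟩,
    tendsto_nhds_limUnder ⟨_, hP β μ hβ⟩⟩, fun β ν hβ => ?_⟩
  set D := FermiJunction.netTransport (FermiJunction.kernelCoeff (w 1))
    fun e => (e : ℂ) * (FermiJunction.sigmoidDeriv (β * e - ν) : ℝ) with hD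
  have dP : HasDerivAt (fun Δν : ℝ => S.energyCurrent w 2 2
      (FermiJunction.invTemp β 0) (FermiJunction.chemPot β ν 0 Δν)) D 0 := by
    refine ((FermiJunction.hasDerivAt_netTransport_energy hd hw1.tame hβ ν).const_add
      (Complex.I * FermiJunction.transport (FermiJunction.kernelCoeff (w 1))
        (fun p => -1 * FermiJunction.kernelCoeff v p) FermiJunction.Reservoir.I
        (FermiJunction.fermi β (ν / β)))).congr_of_eventuallyEq (Eventually.of_forall fun x => ?_)
    refine ((hP _ (FermiJunction.chemPot β ν 0 x)
      (FermiJunction.invTemp_pos hβ hβ)).limUnder_eq).trans ?_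
    rw [FermiJunction.fermi_chemPot hβ, sub_zero]
    rfl
  have dJ : HasDerivAt (fun Δβ : ℝ => S.particleCurrent w 2 2
      (FermiJunction.invTemp β Δβ) (FermiJunction.chemPot β ν Δβ 0)) (-D) 0 := by
    have e : -D = FermiJunction.netTransport (FermiJunction.kernelCoeff (w 1))
        fun e => (-1 : ℂ) * ((e : ℂ) * (FermiJunction.sigmoidDeriv (β * e - ν) : ℝ)) := by
      rw [FermiJunction.netTransport_const_mul
        (FermiJunction.energy_mul_sigmoidDeriv_bound hβ ν), neg_one_mul]
    rw [e]
    refine ((FermiJunction.hasDerivAt_netTransport_particle hd hw1.tame hβ ν).const_add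
      (Complex.I * FermiJunction.transport (FermiJunction.kernelCoeff (w 1))
        (FermiJunction.particleCoeff (FermiJunction.kernelCoeff (w 1))) FermiJunction.Reservoir.I
        (FermiJunction.fermi β (ν / β)))).congr_of_eventuallyEq ?_
    -- The formula for the current needs β^II > 0, hence only holds for Δβ < β; a neighbourhood of 0
    -- is enough for the derivative.
    filter_upwards [gt_mem_nhds hβ] with x hx
    refine ((hJ _ (FermiJunction.chemPot β ν x 0)
      (FermiJunction.invTemp_pos hβ hx)).limUnder_eq).trans ?_
    rw [FermiJunction.fermi_chemPot hx, sub_zero]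
    rfl
  exact ⟨dP.differentiableAt, dJ.differentiableAt, by rw [dP.deriv, dJ.deriv, neg_neg]⟩
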